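/- Let $F$ be a field of positive characteristic and let $n\ge 1$. Let $$\mathrm{AGL}_n(F)=\left\{\begin{pmatrix}1&v\\0&A\end{pmatrix} : v\in F^n,\ A\in \mathrm{GL}_n(F)\right\}$$ be the affine group, acting on the right on row vectors, and let $T$ be its translation group, that is, the kernel of the homomorphism $\mathrm{AGL}_n(F)\to\mathrm{GL}_n(F)$, $\begin{pmatrix}1&v\\0&A\end{pmatrix}\mapsto A$. A subgroup $R$ of $\mathrm{AGL}_n(F)$ is called regular if for every $v\in F^n$ there is a unique element of $R$ with first row $(1,v)$. Then $\mathrm{AGL}_n(F)$ contains a regular subgroup $R$ with $R\cap T=\{1\}$ if and only if one of the following holds: (i) $n=3$ and $|F|=2$; (ii) $n=4$ and $\operatorname{char} F>2$; (iii) $n\ge 5$. -/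

import Mathlib

/-- The affine group `AGL_n(F)`: the group of the invertible block matrices
`(1, v; 0, A)` with `v ∈ F^n` a row vector and `A ∈ GL_n(F)`. The index type `Unit ⊕ Fin n`
stands for `{0} ∪ {1, …, n}`. -/
def AGL (n : ℕ) (F : Type*) [Field F] : Subgroup (GL (Unit ⊕ Fin n) F) where
  carrier := {g | ∃ (v : Fin n → F) (A : GL (Fin n) F),
    (g : Matrix (Unit ⊕ Fin n) (Unit ⊕ Fin n) F) =
      Matrix.fromBlocks 1 (Matrix.replicateRow Unit v) 0 (A : Matrix (Fin n) (Fin n) F)}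
  one_mem' := ⟨0, 1, by simp⟩
  mul_mem' := by
    rintro g h ⟨v, A, hg⟩ ⟨w, B, hh⟩
    refine ⟨w + Matrix.vecMul v (B : Matrix (Fin n) (Fin n) F), A * B, ?_⟩
    rw [Units.val_mul, hg, hh, Matrix.fromBlocks_multiply]
    simp [Matrix.replicateRow_vecMul, Matrix.replicateRow_add]
  inv_mem' := by
    rintro g ⟨v, A, hg⟩
    refine ⟨-Matrix.vecMul v ((A⁻¹ : GL (Fin n) F) : Matrix (Fin n) (Fin n) F), A⁻¹, ?_⟩
    refine Units.inv_eq_of_mul_eq_one_right ?_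
    have hneg : Matrix.replicateRow Unit
        (-Matrix.vecMul v ((A⁻¹ : GL (Fin n) F) : Matrix (Fin n) (Fin n) F)) =
        -(Matrix.replicateRow Unit v * ((A⁻¹ : GL (Fin n) F) : Matrix (Fin n) (Fin n) F)) := by
      rw [← Matrix.replicateRow_vecMul]; rfl
    rw [hg, hneg, Matrix.fromBlocks_multiply, ← Units.val_mul, mul_inv_cancel]
    simp

/-- The epimorphism `π : AGL_n(F) → GL_n(F)`, `(1, v; 0, A) ↦ A`. -/
def AGL.linearPart (n : ℕ) (F : Type*) [Field F] : AGL n F →* GL (Fin n) F :=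
  MonoidHom.toHomUnits
    { toFun := fun g =>
        ((g : GL (Unit ⊕ Fin n) F) : Matrix (Unit ⊕ Fin n) (Unit ⊕ Fin n) F).toBlocks₂₂
      map_one' := by
        rw [OneMemClass.coe_one, Units.val_one, ← Matrix.fromBlocks_one,
          Matrix.toBlocks_fromBlocks₂₂]
      map_mul' := by
        rintro ⟨g, v, A, hg⟩ ⟨h, w, B, hh⟩
        simp [hg, hh, Matrix.fromBlocks_multiply] }

/-- The translation group: the kernel of `π`. -/
def AGL.translations (n : ℕ) (F : Type*) [Field F] : Subgroup (AGL n F) :=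
  (AGL.linearPart n F).ker

/-- A subgroup `R` of `AGL_n(F)` is regular if, for every `v ∈ F^n`, there is a unique element of
`R` whose first row is the affine point `(1, v)`. -/
def AGL.IsRegular {n : ℕ} {F : Type*} [Field F] (R : Subgroup (AGL n F)) : Prop :=
  ∀ v : Fin n → F, ∃! r : AGL n F, r ∈ R ∧
    ((r : GL (Unit ⊕ Fin n) F) : Matrix (Unit ⊕ Fin n) (Unit ⊕ Fin n) F) (Sum.inl ()) =
      Sum.elim (fun _ => 1) v

/-! Write the element of `R` that moves `0` to `v` as `x ↦ A v x + v`. Then `V` carries the group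
law `v ∘ w = A w v + w`, linear parts satisfy `A (v ∘ w) = A w * A v`, and `R ∩ T = 1` says that `A`
is injective.

Necessity. In characteristic `p` all `A v` are unipotent, so by Kolchin they lower a series of
subspaces of length at most `n`, and commutators lower it further. If `R` were abelian, a common
fixed vector `u` would satisfy `A u = 1`; hence `R` is not abelian and `n ≥ 3`. For `n ≤ 4` this
depth count gives a central commutator `z` with `(A z - 1) ^ 2 = 0` (`exists_central`). Centrality
reads `A v z - z = (A z - 1) v`, so if `A z - 1` has rank one, `A v z = z + f v • u` with `f` an
invariant functional (`exists_transvection`). The rank is one automatically for `n = 3`, and because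
of characteristic two for `n = 4`. In an adapted basis `R` becomes unitriangular, with entries that
are functions of `v`, one of them the coordinate `v 0`. Commutators of the elements `(x, 0, …)` with
a fixed element run over a curve `x ↦ (x s, x g - x² s)` up to a term common to all such curves.
Faithfulness makes curves from different elements parts of the graph of one function, which forces
equal slopes `s` when `|F| > 2` (`eq_of_quadratic_graph`). This contradicts additivity of `s` for `n
= 3` and its injectivity for `n = 4`; in the latter case the field of two elements is excluded
directly.

Existence. Given a quadratic form `Q` on `W` with nondegenerate polar form and a faithful additive
family of isometries, a law on `W × F × S` is twisted by the polar form so that `t - Q x` becomes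
additive and can drive the isometries (`exists_of_isometries`). A ternary form gives `n = 4` in odd
characteristic, hyperbolic forms give all `n ≥ 5`, and `n = 3` over two elements is explicit. -/

open Module

/-! ### Kolchin's theorem for unipotent submonoids -/

namespace Submonoid

/-- In an irreducible submonoid of unipotent endomorphisms over an algebraically closed field,
every vector is fixed. -/
theorem exists_fixed_of_irreducible {K V : Type*} [Field K] [IsAlgClosed K] [AddCommGroup V]
    [Module K V] [FiniteDimensional K V] [Nontrivial V] (S : Submonoid (End K V))
    (hS : ∀ a ∈ S, IsNilpotent (a - 1))
    (hirr : ∀ W : Submodule K V, (∀ a ∈ S, ∀ x ∈ W, a x ∈ W) → W = ⊥ ∨ W = ⊤) :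
    ∃ x : V, x ≠ 0 ∧ ∀ a ∈ S, a x = x := by
  set A := Algebra.adjoin K (S : Set (End K V)) with hA
  have htr0 : ∀ a ∈ S, LinearMap.trace K V (a - 1) = 0 := fun a ha =>
    (LinearMap.isNilpotent_trace_of_isNilpotent (hS a ha)).eq_zero
  -- `S` spans its algebra, and `(a - 1) s` is a difference of the nilpotents `a s - 1` and `s - 1`.
  have htr : ∀ a ∈ S, ∀ T ∈ A, LinearMap.trace K V ((a - 1) * T) = 0 := by
    intro a ha T hT
    rw [hA, ← Subalgebra.mem_toSubmodule, Algebra.adjoin_eq_span, Submonoid.closure_eq] at hT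
    induction hT using Submodule.span_induction with
    | mem s hs =>
      have : (a - 1) * s = (a * s - 1) - (s - 1) := by noncomm_ring
      rw [this, map_sub, htr0 _ (S.mul_mem ha hs), htr0 _ hs, sub_zero]
    | zero => simp
    | add x y _ _ hx hy => rw [mul_add, map_add, hx, hy, add_zero]
    | smul c x _ hx => rw [mul_smul_comm, map_smul, hx, smul_zero]
  have htrans : ∀ x : V, x ≠ 0 → ∀ y, ∃ T ∈ A, T x = y := by
    intro x hx y
    have h := hirr ((Subalgebra.toSubmodule A).map (LinearMap.applyₗ x)) (by
      rintro a ha _ ⟨T, hT, rfl⟩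
      exact ⟨a * T, A.mul_mem (Algebra.subset_adjoin ha) hT, rfl⟩)
    have hne : (Subalgebra.toSubmodule A).map (LinearMap.applyₗ x) ≠ ⊥ := by
      intro h0
      have : x ∈ (Subalgebra.toSubmodule A).map (LinearMap.applyₗ x) := ⟨1, A.one_mem, rfl⟩
      rw [h0] at this
      exact hx this
    have hy : y ∈ (Subalgebra.toSubmodule A).map (LinearMap.applyₗ x) := by
      rw [h.resolve_left hne]; trivial
    obtain ⟨T, hT, h⟩ := hy
    exact ⟨T, hT, h⟩
  -- As in Burnside's theorem, a nonzero element of least rank in the algebra has rank one.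
  obtain ⟨T, ⟨hTA, hT0⟩, hmin⟩ :=
    (measure (fun T : End K V => finrank K (LinearMap.range T))).wf.has_min
      {T | T ∈ A ∧ T ≠ 0} ⟨1, A.one_mem, one_ne_zero⟩
  obtain ⟨x, hx⟩ : ∃ x, T x ≠ 0 := by
    by_contra! h
    exact hT0 (LinearMap.ext h)
  have hrank : ∀ y, ∃ c : K, T y = c • T x := by
    by_contra! h
    obtain ⟨y, hy⟩ := h
    obtain ⟨U, hU, hUy⟩ := htrans (T x) hx y
    have hinv : ∀ z ∈ LinearMap.range T, (T * U) z ∈ LinearMap.range T := fun z _ => ⟨U z, rfl⟩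
    set g : End K (LinearMap.range T) := (T * U).restrict hinv with hg
    have : Nontrivial (LinearMap.range T) :=
      ⟨⟨⟨T x, x, rfl⟩, 0, fun h0 => hx (congrArg Subtype.val h0)⟩⟩
    obtain ⟨c, hc⟩ := Module.End.exists_eigenvalue g
    obtain ⟨w, hw⟩ := hc.exists_hasEigenvector
    have hker : LinearMap.ker (g - algebraMap K _ c) ≠ ⊥ := by
      intro h0
      apply hw.2
      have : w ∈ LinearMap.ker (g - algebraMap K _ c) := by
        simpa [sub_eq_zero] using hw.apply_eq_smul
      rw [h0] at this
      exact this
    -- Since `c` is an eigenvalue of `T U` on the range of `T`, this element has smaller rank. It is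
    -- nonzero because it sends `x` to `T y - c • T x`.
    refine hmin (T * U * T - c • T) ⟨A.sub_mem (A.mul_mem (A.mul_mem hTA hU) hTA)
      (A.smul_mem hTA c), ?_⟩ ?_
    · intro h0
      have := LinearMap.congr_fun h0 x
      simp only [LinearMap.sub_apply, Module.End.mul_apply, LinearMap.smul_apply,
        LinearMap.zero_apply, hUy, sub_eq_zero] at this
      exact hy c this
    · change finrank K _ < finrank K _
      have hle : LinearMap.range (T * U * T - c • T) ≤
          (LinearMap.range (g - algebraMap K _ c)).map (LinearMap.range T).subtype := by
        rintro _ ⟨z, rfl⟩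
        exact ⟨_, ⟨⟨T z, z, rfl⟩, rfl⟩, by simp [hg]⟩
      have h1 := Submodule.finrank_mono hle
      have h2 := Submodule.finrank_map_le (LinearMap.range T).subtype
        (LinearMap.range (g - algebraMap K _ c))
      have h3 := LinearMap.finrank_range_add_finrank_ker (g - algebraMap K _ c)
      have h4 : 0 < finrank K (LinearMap.ker (g - algebraMap K _ c)) := by
        rw [Nat.pos_iff_ne_zero]
        exact fun h => hker (Submodule.finrank_eq_zero.1 h)
      omega
  obtain ⟨f, hf⟩ := Module.Projective.exists_dual_eq_one K hx
  have hT : T = (f ∘ₗ T).smulRight (T x) := by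
    ext y
    obtain ⟨c, hc⟩ := hrank y
    simp [hc, hf]
  -- Choosing `U` with `U (T x) = y` makes `(a - 1) U T` a rank-one map whose trace is the left-hand
  -- side.
  have hfix : ∀ a ∈ S, ∀ y, f (T (a y - y)) = 0 := by
    intro a ha y
    obtain ⟨U, hU, hUy⟩ := htrans (T x) hx y
    have h := htr a ha (U * T) (A.mul_mem hU hTA)
    have h' : (a - 1) * (U * T) = (f ∘ₗ T).smulRight (a y - y) := by
      rw [← hUy]
      ext z
      obtain ⟨c, hc⟩ := hrank z
      simp [hc, hf, smul_sub]
    rw [h', LinearMap.trace_smulRight] at h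
    exact h
  have hk : LinearMap.ker (f ∘ₗ T) = ⊥ := by
    refine (hirr (LinearMap.ker (f ∘ₗ T)) ?_).resolve_right ?_
    · intro a ha y hy
      have := hfix a ha y
      rw [map_sub, map_sub, sub_eq_zero] at this
      rw [LinearMap.mem_ker] at hy ⊢
      exact this.trans hy
    · intro h
      have : x ∈ LinearMap.ker (f ∘ₗ T) := by rw [h]; trivial
      rw [LinearMap.mem_ker, LinearMap.comp_apply, hf] at this
      exact one_ne_zero this
  refine ⟨x, fun h => hx (by rw [h, map_zero]), fun a ha => ?_⟩
  have : a x - x ∈ LinearMap.ker (f ∘ₗ T) := hfix a ha x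
  rw [hk] at this
  exact sub_eq_zero.1 this

/-- The submonoid of endomorphisms of an invariant subspace induced by `S`. -/
def induced {K V : Type*} [Field K] [AddCommGroup V] [Module K V] (S : Submonoid (End K V))
    (W : Submodule K V) : Submonoid (End K W) where
  carrier := {b | ∃ a ∈ S, ∀ x : W, (b x : V) = a x}
  one_mem' := ⟨1, S.one_mem, fun _ => rfl⟩
  mul_mem' := by
    rintro b b' ⟨a, ha, h⟩ ⟨a', ha', h'⟩
    exact ⟨a * a', S.mul_mem ha ha', fun x => by simp [h, h']⟩

theorem isNilpotent_of_mem_induced {K V : Type*} [Field K] [AddCommGroup V] [Module K V]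
    {S : Submonoid (End K V)} (hS : ∀ a ∈ S, IsNilpotent (a - 1)) {W : Submodule K V}
    {b : End K W} (hb : b ∈ S.induced W) : IsNilpotent (b - 1) := by
  obtain ⟨a, ha, h⟩ := hb
  obtain ⟨m, hm⟩ := hS a ha
  refine ⟨m, LinearMap.ext fun x => Subtype.ext ?_⟩
  have key : ∀ k : ℕ, (((b - 1) ^ k) x : V) = ((a - 1) ^ k) x := by
    intro k
    induction k with
    | zero => rfl
    | succ k ih => rw [pow_succ', pow_succ', Module.End.mul_apply, Module.End.mul_apply, ← ih]
                   simp [h]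
  rw [key, hm]
  rfl

/-- **Kolchin's theorem** over an algebraically closed field. -/
theorem exists_fixed_of_isAlgClosed {K : Type*} [Field K] [IsAlgClosed K] {V : Type*}
    [AddCommGroup V] [Module K V] [FiniteDimensional K V] [Nontrivial V]
    (S : Submonoid (End K V)) (hS : ∀ a ∈ S, IsNilpotent (a - 1)) :
    ∃ x : V, x ≠ 0 ∧ ∀ a ∈ S, a x = x := by
  obtain ⟨n, hn⟩ : ∃ n, finrank K V = n := ⟨_, rfl⟩
  induction n using Nat.strong_induction_on generalizing V with
  | _ n ih =>
    by_cases hirr : ∀ W : Submodule K V, (∀ a ∈ S, ∀ x ∈ W, a x ∈ W) → W = ⊥ ∨ W = ⊤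
    · exact exists_fixed_of_irreducible S hS hirr
    · push Not at hirr
      obtain ⟨W, hW, hbot, htop⟩ := hirr
      have : Nontrivial W := Submodule.nontrivial_iff_ne_bot.2 hbot
      obtain ⟨x, hx, hfix⟩ := ih (finrank K W)
        (hn ▸ Submodule.finrank_lt htop) (S.induced W)
        (fun b hb => isNilpotent_of_mem_induced hS hb) rfl
      refine ⟨x, fun h => hx (Subtype.ext h), fun a ha => ?_⟩
      exact congrArg Subtype.val (hfix (a.restrict (hW a ha)) ⟨a, ha, fun _ => rfl⟩)

/-- **Kolchin's theorem**, dual form: a submonoid of unipotent endomorphisms fixes a nonzero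
functional. -/
theorem exists_fixed_functional {F V : Type*} [Field F] [AddCommGroup V] [Module F V]
    [FiniteDimensional F V] [Nontrivial V] (S : Submonoid (End F V))
    (hS : ∀ a ∈ S, IsNilpotent (a - 1)) :
    ∃ f : V →ₗ[F] F, f ≠ 0 ∧ ∀ a ∈ S, ∀ x, f (a x) = f x := by
  let K := AlgebraicClosure F
  let pre : End F V → End K (V →ₗ[F] K) := fun a =>
    { toFun := fun f => f ∘ₗ a
      map_add' := fun _ _ => rfl
      map_smul' := fun _ _ => rfl }
  let S' : Submonoid (End K (V →ₗ[F] K)) :=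
    { carrier := pre '' S
      one_mem' := ⟨1, S.one_mem, rfl⟩
      mul_mem' := by
        rintro _ _ ⟨a, ha, rfl⟩ ⟨b, hb, rfl⟩
        exact ⟨b * a, S.mul_mem hb ha, rfl⟩ }
  have : Nontrivial (V →ₗ[F] K) := by
    obtain ⟨x, hx⟩ := exists_ne (0 : V)
    obtain ⟨f, hf⟩ := Module.Projective.exists_dual_eq_one F hx
    refine ⟨Algebra.linearMap F K ∘ₗ f, 0, fun h => ?_⟩
    have := LinearMap.congr_fun h x
    simp [hf] at this
  obtain ⟨f, hf, hfix⟩ := exists_fixed_of_isAlgClosed S' (by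
    rintro _ ⟨a, ha, rfl⟩
    obtain ⟨m, hm⟩ := hS a ha
    refine ⟨m, ?_⟩
    have key : ∀ (k : ℕ) (g : V →ₗ[F] K), ((pre a - 1) ^ k) g = g ∘ₗ ((a - 1) ^ k) := by
      intro k
      induction k with
      | zero => intro g; rfl
      | succ k ih =>
        intro g
        rw [pow_succ, Module.End.mul_apply, ih, pow_succ']
        ext y
        simp [pre]
    ext g y
    rw [key, hm]
    simp)
  obtain ⟨x, hx⟩ : ∃ x, f x ≠ 0 := by
    by_contra! h
    exact hf (LinearMap.ext h)
  -- The invariant functional takes values in the algebraic closure; an `F`-linear `ψ` brings it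
  -- down to `F` without losing invariance.
  obtain ⟨ψ, hψ⟩ := Module.Projective.exists_dual_eq_one F hx
  refine ⟨ψ ∘ₗ f, fun h => ?_, fun a ha y => ?_⟩
  · have := LinearMap.congr_fun h x
    simp [hψ] at this
  · have := LinearMap.congr_fun (hfix _ ⟨a, ha, rfl⟩) y
    exact congrArg ψ this

/-! ### The displacement series and the depth of commutators -/

/-- The subspace spanned by the differences `a x - x` with `a ∈ S` and `x ∈ W`. -/
def displacement {F V : Type*} [Field F] [AddCommGroup V] [Module F V] (S : Submonoid (End F V))
    (W : Submodule F V) : Submodule F V :=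
  Submodule.span F {y | ∃ a ∈ S, ∃ x ∈ W, y = a x - x}

section displacement

variable {F V : Type*} [Field F] [AddCommGroup V] [Module F V] {S : Submonoid (End F V)}
  {W : Submodule F V}

theorem sub_mem_displacement {a : End F V} (ha : a ∈ S) {x : V} (hx : x ∈ W) :
    a x - x ∈ S.displacement W :=
  Submodule.subset_span ⟨a, ha, x, hx, rfl⟩

theorem displacement_le (hW : ∀ a ∈ S, ∀ x ∈ W, a x ∈ W) : S.displacement W ≤ W := by
  refine Submodule.span_le.2 ?_
  rintro _ ⟨a, ha, x, hx, rfl⟩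
  exact W.sub_mem (hW a ha x hx) hx

theorem displacement_invariant (hW : ∀ a ∈ S, ∀ x ∈ W, a x ∈ W) :
    ∀ a ∈ S, ∀ x ∈ S.displacement W, a x ∈ S.displacement W := by
  intro a ha x hx
  have := (S.displacement W).add_mem (sub_mem_displacement ha (displacement_le hW hx)) hx
  rwa [sub_add_cancel] at this

/-- The nonzero invariant functional on `W` given by Kolchin's theorem kills every `a x - x`. -/
theorem displacement_lt [FiniteDimensional F V] (hS : ∀ a ∈ S, IsNilpotent (a - 1))
    (hW : ∀ a ∈ S, ∀ x ∈ W, a x ∈ W) (h0 : W ≠ ⊥) : S.displacement W < W := by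
  refine lt_of_le_of_ne (displacement_le hW) fun h => ?_
  have : Nontrivial W := Submodule.nontrivial_iff_ne_bot.2 h0
  obtain ⟨f, hf, hfix⟩ := exists_fixed_functional (S.induced W)
    (fun b hb => isNilpotent_of_mem_induced hS hb)
  obtain ⟨x, hx⟩ : ∃ x, f x ≠ 0 := by
    by_contra! h
    exact hf (LinearMap.ext h)
  have hle : W ≤ (LinearMap.ker f).map W.subtype := by
    conv_lhs => rw [← h]
    refine Submodule.span_le.2 ?_
    rintro _ ⟨a, ha, x, hx, rfl⟩
    refine ⟨a.restrict (hW a ha) ⟨x, hx⟩ - ⟨x, hx⟩, ?_, rfl⟩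
    rw [SetLike.mem_coe, LinearMap.mem_ker, map_sub, hfix _ ⟨a, ha, fun _ => rfl⟩, sub_self]
  obtain ⟨y, hy, hyx⟩ := hle x.2
  have : y = x := Subtype.ext hyx
  exact hx (this ▸ hy)

end displacement

/-- The descending series `V ≥ [S, V] ≥ [S, [S, V]] ≥ ⋯`. -/
def displacementSeries {F V : Type*} [Field F] [AddCommGroup V] [Module F V]
    (S : Submonoid (End F V)) : ℕ → Submodule F V
  | 0 => ⊤
  | k + 1 => S.displacement (S.displacementSeries k)

/-- `T` moves each term of the displacement series `k` steps down. -/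
def Lowers {F V : Type*} [Field F] [AddCommGroup V] [Module F V] (S : Submonoid (End F V))
    (k : ℕ) (T : End F V) : Prop :=
  ∀ j, ∀ x ∈ S.displacementSeries j, T x ∈ S.displacementSeries (j + k)

section series

variable {F V : Type*} [Field F] [AddCommGroup V] [Module F V] {S : Submonoid (End F V)}

theorem displacementSeries_invariant (j : ℕ) :
    ∀ a ∈ S, ∀ x ∈ S.displacementSeries j, a x ∈ S.displacementSeries j := by
  induction j with
  | zero => intros; trivial
  | succ j ih => exact displacement_invariant ih

theorem finrank_displacementSeries_le [FiniteDimensional F V]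
    (hS : ∀ a ∈ S, IsNilpotent (a - 1)) (j : ℕ) :
    finrank F (S.displacementSeries j) ≤ finrank F V - j := by
  induction j with
  | zero => exact Submodule.finrank_le _
  | succ j ih =>
    by_cases h : S.displacementSeries j = ⊥
    · have : S.displacementSeries (j + 1) = ⊥ :=
        eq_bot_iff.2 (h ▸ displacement_le (displacementSeries_invariant j))
      rw [this, finrank_bot]
      exact Nat.zero_le _
    · have := Submodule.finrank_lt_finrank_of_lt
        (displacement_lt hS (displacementSeries_invariant j) h)
      change finrank F (S.displacement (S.displacementSeries j)) ≤ _
      omega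

theorem displacementSeries_eq_bot [FiniteDimensional F V]
    (hS : ∀ a ∈ S, IsNilpotent (a - 1)) {j : ℕ} (hj : finrank F V ≤ j) :
    S.displacementSeries j = ⊥ := by
  have := finrank_displacementSeries_le hS j
  exact Submodule.finrank_eq_zero.1 (by omega)

theorem Lowers.eq_zero [FiniteDimensional F V] (hS : ∀ a ∈ S, IsNilpotent (a - 1)) {k : ℕ}
    (hk : finrank F V ≤ k) {T : End F V} (hT : S.Lowers k T) : T = 0 := by
  ext x
  have := hT 0 x trivial
  rwa [zero_add, displacementSeries_eq_bot hS hk] at this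

theorem lowers_sub_one {a : End F V} (ha : a ∈ S) : S.Lowers 1 (a - 1) := fun _ _ hx =>
  sub_mem_displacement ha hx

theorem lowers_of_mem {a : End F V} (ha : a ∈ S) : S.Lowers 0 a := fun j x hx =>
  displacementSeries_invariant j a ha x hx

theorem Lowers.mul {k l : ℕ} {T U : End F V} (hT : S.Lowers k T) (hU : S.Lowers l U) :
    S.Lowers (l + k) (T * U) := fun j x hx => by
  rw [← add_assoc]
  exact hT _ _ (hU j x hx)

theorem Lowers.sub {k : ℕ} {T U : End F V} (hT : S.Lowers k T) (hU : S.Lowers k U) :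
    S.Lowers k (T - U) := fun j x hx => Submodule.sub_mem _ (hT j x hx) (hU j x hx)

/-- The commutator is unchanged when `1` is subtracted from both factors, and `a - 1` contributes
one more step. -/
theorem Lowers.commutator {k : ℕ} {a b : End F V} (ha : a ∈ S) (hb : S.Lowers k (b - 1)) :
    S.Lowers (k + 1) (a * b - b * a) := by
  have : a * b - b * a = (a - 1) * (b - 1) - (b - 1) * (a - 1) := by noncomm_ring
  rw [this]
  refine ((lowers_sub_one ha).mul hb).sub ?_
  rw [add_comm]
  exact hb.mul (lowers_sub_one ha)

/-- Every vector of the last nonzero term of the displacement series is fixed. -/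
theorem exists_fixed [FiniteDimensional F V] [Nontrivial V]
    (hS : ∀ a ∈ S, IsNilpotent (a - 1)) : ∃ x : V, x ≠ 0 ∧ ∀ a ∈ S, a x = x := by
  classical
  have hex : ∃ j, S.displacementSeries j = ⊥ := ⟨_, displacementSeries_eq_bot hS le_rfl⟩
  obtain ⟨j, hj⟩ : ∃ j, Nat.find hex = j + 1 := by
    refine Nat.exists_eq_succ_of_ne_zero fun h => ?_
    have := Nat.find_spec hex
    rw [h] at this
    exact top_ne_bot this
  have hbot : S.displacementSeries (j + 1) = ⊥ := hj ▸ Nat.find_spec hex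
  obtain ⟨x, hx, hx0⟩ := Submodule.exists_mem_ne_zero_of_ne_bot
    (Nat.find_min hex (show j < Nat.find hex by omega))
  refine ⟨x, hx0, fun a ha => ?_⟩
  have := lowers_sub_one ha j x hx
  rw [hbot] at this
  exact sub_eq_zero.1 this

end series

end Submonoid

/-! ### Regular subgroups as families of linear parts -/

/-- The linear parts of a regular subgroup of the affine group of `V`: the element of the subgroup
moving `0` to `v` is `x ↦ A v x + v`. -/
structure IsRegularFamily {F V : Type*} [Field F] [AddCommGroup V] [Module F V]
    (A : V → End F V) : Prop where
  map_zero : A 0 = 1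
  map_circ : ∀ v w, A (A w v + w) = A w * A v
  isUnit : ∀ v, IsUnit (A v)

/-- The regular subgroup described by `A` contains no nontrivial translation. -/
def IsTranslationFree {F V : Type*} [Field F] [AddCommGroup V] [Module F V]
    (A : V → End F V) : Prop :=
  ∀ v, A v = 1 → v = 0

namespace IsRegularFamily

variable {F V : Type*} [Field F] [AddCommGroup V] [Module F V] {A : V → End F V}

theorem exists_apply_eq (hA : IsRegularFamily A) (v x : V) : ∃ y, A v y = x := by
  obtain ⟨u, hu⟩ := hA.isUnit v
  refine ⟨(↑u⁻¹ : End F V) x, ?_⟩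
  rw [← hu, ← Module.End.mul_apply, Units.mul_inv, Module.End.one_apply]

theorem exists_mul_eq_one (hA : IsRegularFamily A) (v : V) : ∃ w, A w * A v = 1 := by
  obtain ⟨x, hx⟩ := hA.exists_apply_eq v (-v)
  have h : A v * A x = 1 := by rw [← hA.map_circ, hx, neg_add_cancel, hA.map_zero]
  refine ⟨x, ?_⟩
  obtain ⟨u, hu⟩ := hA.isUnit v
  rw [← hu] at h ⊢
  rw [← Units.inv_eq_of_mul_eq_one_right h, Units.inv_mul]

/-- Writing `v = A w y + w` gives `A v = A w * A y`, so equal linear parts make `y` a translation.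
-/
theorem injective (hA : IsRegularFamily A) (hT : IsTranslationFree A) :
    Function.Injective A := by
  intro v w h
  obtain ⟨y, hy⟩ := hA.exists_apply_eq w (v - w)
  have h1 : A v = A w * A y := by rw [← hA.map_circ, hy, sub_add_cancel]
  have h2 : A y = 1 := by
    refine (hA.isUnit w).mul_left_cancel ?_
    rw [← h1, h, mul_one]
  rw [hT y h2, _root_.map_zero] at hy
  exact (sub_eq_zero.1 hy.symm)

/-- The submonoid of all linear parts. -/
def toSubmonoid (hA : IsRegularFamily A) : Submonoid (End F V) where
  carrier := Set.range A
  one_mem' := ⟨0, hA.map_zero⟩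
  mul_mem' := by
    rintro _ _ ⟨v, rfl⟩ ⟨w, rfl⟩
    exact ⟨_, hA.map_circ w v⟩

theorem mem_toSubmonoid (hA : IsRegularFamily A) (v : V) : A v ∈ hA.toSubmonoid := ⟨v, rfl⟩

/-- A regular subgroup of the affine group in positive characteristic is unipotent. -/
theorem isNilpotent_sub_one [FiniteDimensional F V] (hA : IsRegularFamily A) (p : ℕ)
    [Fact p.Prime] [CharP F p] (v : V) : IsNilpotent (A v - 1) := by
  -- The affine map `x ↦ A v x + v`, made linear on `V × F`; its powers again come from the family.
  let g : End F (V × F) :=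
    ((A v).coprod (LinearMap.toSpanSingleton F V v)).prod (LinearMap.snd F V F)
  have hg : ∀ x t, g (x, t) = (A v x + t • v, t) := fun x t => by simp [g]
  have hpow : ∀ k : ℕ, ∃ w, A w = A v ^ k ∧ ∀ x t, (g ^ k) (x, t) = (A w x + t • w, t) := by
    intro k
    induction k with
    | zero => exact ⟨0, by simp [hA.map_zero], by simp [hA.map_zero]⟩
    | succ k ih =>
      obtain ⟨w, hw, h⟩ := ih
      refine ⟨A v w + v, by rw [hA.map_circ, hw, pow_succ'], fun x t => ?_⟩
      rw [pow_succ', Module.End.mul_apply, h, hg, hA.map_circ]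
      simp [add_assoc]
  -- Fitting decomposition of `g - 1`. The exponent `m` is a power of `p` past the stable range, so
  -- that `(g - 1) ^ m = g ^ m - 1`.
  obtain ⟨k₀, hk₀⟩ := Filter.eventually_atTop.1
    (LinearMap.eventually_isCompl_ker_pow_range_pow (g - 1))
  have hlt : k₀ < p ^ (k₀ + 1) := (Nat.lt_succ_self k₀).trans (Nat.lt_pow_self
    (Fact.out : p.Prime).one_lt)
  set m := p ^ (k₀ + 1) with hm
  have hc := hk₀ m hlt.le
  obtain ⟨w, hw, hgw⟩ := hpow m
  have : CharP (End F (V × F)) p := charP_of_injective_algebraMap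
    (FaithfulSMul.algebraMap_injective F (End F (V × F))) p
  have hsub : (g - 1) ^ m = g ^ m - 1 := by
    rw [hm, sub_pow_char_pow_of_commute _ _ (Commute.one_right g), one_pow]
  -- Vectors in the range of `g ^ m - 1` have last coordinate `0`, so the kernel component of `(0,
  -- 1)` is `(x, 1)`: the affine map `g ^ m` fixes the point `x`, and regularity makes its linear
  -- part trivial.
  obtain ⟨⟨x, s⟩, hx, ⟨y, t⟩, hy, hxy⟩ := Submodule.mem_sup.1
    (hc.sup_eq_top ▸ Submodule.mem_top : ((0, 1) : V × F) ∈ _)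
  obtain ⟨⟨y', t'⟩, hy'⟩ := hy
  rw [LinearMap.mem_ker, hsub, LinearMap.sub_apply, hgw] at hx
  rw [hsub, LinearMap.sub_apply, hgw] at hy'
  simp only [Module.End.one_apply, Prod.mk_sub_mk, Prod.mk.injEq, sub_self, Prod.mk_eq_zero,
    and_true, Prod.mk_add_mk] at hx hy' hxy
  obtain rfl : s = 1 := by rw [← hxy.2, ← hy'.2, add_zero]
  rw [one_smul, sub_eq_zero] at hx
  have hw1 : A w = 1 := by
    refine (hA.isUnit x).mul_right_cancel ?_
    rw [← hA.map_circ, hx, one_mul]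
  rcases subsingleton_or_nontrivial V with _ | _
  · exact ⟨0, Subsingleton.elim _ _⟩
  have : CharP (End F V) p := charP_of_injective_algebraMap
    (FaithfulSMul.algebraMap_injective F (End F V)) p
  exact ⟨m, by rw [hm, sub_pow_char_pow_of_commute _ _ (Commute.one_right _), one_pow, ← hm, ← hw,
    hw1, sub_self]⟩

/-- The commutator of `v` and `w`. -/
theorem exists_commutator (hA : IsRegularFamily A) (v w : V) :
    ∃ k u, A (A v w + v) k + (A v w + v) = A w v + w ∧
      A k - 1 = A u * (A w * A v - A v * A w) := by
  obtain ⟨k, hk⟩ := hA.exists_apply_eq (A v w + v) (A w v + w - (A v w + v))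
  obtain ⟨u, hu⟩ := hA.exists_mul_eq_one (A v w + v)
  have h : A (A v w + v) * A k = A w * A v := by
    rw [← hA.map_circ, hk, sub_add_cancel, hA.map_circ]
  refine ⟨k, u, by rw [hk, sub_add_cancel], ?_⟩
  rw [mul_sub, ← h, ← mul_assoc, hu, one_mul, ← hA.map_circ, hu]

/-! ### Noncommutativity and central commutators in small dimension -/

section commutators

variable [FiniteDimensional F V]

theorem unipotent (hA : IsRegularFamily A) (p : ℕ) [Fact p.Prime] [CharP F p] :
    ∀ a ∈ hA.toSubmonoid, IsNilpotent (a - 1) := by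
  rintro _ ⟨v, rfl⟩
  exact hA.isNilpotent_sub_one p v

/-- For a common fixed vector `u`, commutativity reads `A u v + u = u + v` for all `v`, so `u` is a
nonzero translation. -/
theorem exists_not_commute [Nontrivial V] (hA : IsRegularFamily A) (hT : IsTranslationFree A)
    (hU : ∀ a ∈ hA.toSubmonoid, IsNilpotent (a - 1)) : ∃ v w, A v * A w ≠ A w * A v := by
  by_contra! h
  obtain ⟨u, hu, hfix⟩ := Submonoid.exists_fixed hU
  refine hu (hT u (LinearMap.ext fun v => ?_))
  have h1 : A u v + u = A v u + v := hA.injective hT (by rw [hA.map_circ, hA.map_circ, h])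
  rw [hfix _ (hA.mem_toSubmonoid v), add_comm u v] at h1
  simpa using h1

/-- A commutator lowers the displacement series by two steps, hence vanishes in dimension at most
two. -/
theorem three_le_finrank [Nontrivial V] (hA : IsRegularFamily A) (hT : IsTranslationFree A)
    (hU : ∀ a ∈ hA.toSubmonoid, IsNilpotent (a - 1)) : 3 ≤ finrank F V := by
  by_contra! h
  obtain ⟨v, w, hvw⟩ := hA.exists_not_commute hT hU
  have := Submonoid.Lowers.commutator (hA.mem_toSubmonoid v)
    (Submonoid.lowers_sub_one (hA.mem_toSubmonoid w))
  exact hvw (sub_eq_zero.1 (this.eq_zero hU (by omega)))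

/-- In dimension at most four there is a central commutator `z` with `(A z - 1) ^ 2 = 0`. -/
theorem exists_central [Nontrivial V] (hA : IsRegularFamily A) (hT : IsTranslationFree A)
    (hU : ∀ a ∈ hA.toSubmonoid, IsNilpotent (a - 1)) (h4 : finrank F V ≤ 4) :
    ∃ z v w, A z ≠ 1 ∧ (∀ x, A x * A z = A z * A x) ∧ (A z - 1) * (A z - 1) = 0 ∧
      A (A v w + v) z + (A v w + v) = A w v + w := by
  obtain ⟨v, w, hvw⟩ := hA.exists_not_commute hT hU
  obtain ⟨k, u, hk, hku⟩ := hA.exists_commutator v w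
  have hlow : hA.toSubmonoid.Lowers 2 (A k - 1) := by
    rw [hku]
    exact (Submonoid.lowers_of_mem (hA.mem_toSubmonoid u)).mul
      (Submonoid.Lowers.commutator (hA.mem_toSubmonoid w)
        (Submonoid.lowers_sub_one (hA.mem_toSubmonoid v)))
  have hk1 : A k ≠ 1 := by
    intro h
    rw [h, sub_self] at hku
    have h0 := (hA.isUnit u).mul_left_cancel (hku.symm.trans (mul_zero _).symm)
    exact hvw (sub_eq_zero.1 h0).symm
  -- `A k - 1` lowers by two steps, so its square lowers by four and vanishes. If `k` is not
  -- central, one further commutator lowers by three steps, and it is central because depth four is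
  -- zero.
  by_cases hc : ∀ x, A x * A k = A k * A x
  · exact ⟨k, v, w, hk1, hc, (hlow.mul hlow).eq_zero hU (by omega), hk⟩
  · push Not at hc
    obtain ⟨x, hx⟩ := hc
    obtain ⟨l, u', hl, hlu⟩ := hA.exists_commutator k x
    have hlow' : hA.toSubmonoid.Lowers 3 (A l - 1) := by
      rw [hlu]
      exact (Submonoid.lowers_of_mem (hA.mem_toSubmonoid u')).mul
        (Submonoid.Lowers.commutator (hA.mem_toSubmonoid x) hlow)
    refine ⟨l, k, x, fun h => ?_, fun y => ?_, (hlow'.mul hlow').eq_zero hU (by omega), hl⟩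
    · rw [h, sub_self] at hlu
      have h0 := (hA.isUnit u').mul_left_cancel (hlu.symm.trans (mul_zero _).symm)
      exact hx (sub_eq_zero.1 h0)
    · exact sub_eq_zero.1
        ((Submonoid.Lowers.commutator (hA.mem_toSubmonoid y) hlow').eq_zero hU (by omega))

end commutators

end IsRegularFamily

/-- Two additive parametrisations of the graph of one function force the parameters to agree. -/
theorem eq_of_quadratic_graph {F : Type*} [Field F] {s s' g g' y : F} (hs : s ≠ 0) (hs' : s' ≠ 0)
    (hy0 : y ≠ 0) (hy1 : y ≠ 1)
    (h : ∀ x x', x * s = x' * s' → x * g - x ^ 2 * s = x' * g' - x' ^ 2 * s') : s = s' := by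
  -- Scaling the solution `(s', s)` by `y` multiplies linear terms by `y` and quadratic ones by `y ^
  -- 2`; `y ≠ 0, 1` separates them.
  have h1 := h s' s (mul_comm _ _)
  have h2 := h (y * s') (y * s) (by ring)
  have h3 : y * (y - 1) * (s * s') * (s - s') = 0 := by linear_combination h2 - y * h1
  have h4 : y * (y - 1) * (s * s') ≠ 0 :=
    mul_ne_zero (mul_ne_zero hy0 (sub_ne_zero.2 hy1)) (mul_ne_zero hs hs')
  exact sub_eq_zero.1 ((mul_eq_zero.1 h3).resolve_left h4)

/-! ### Dimension three in coordinates -/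

/-- The product of a three-dimensional regular subgroup whose elements have linear parts
`(1, a, b; 0, 1, v 0; 0, 0, 1)`. -/
def circThree {F : Type*} [Field F] (a b : (Fin 3 → F) → F) (v w : Fin 3 → F) : Fin 3 → F :=
  ![v 0 + w 0, v 1 + w 1 + v 0 * a w, v 2 + w 2 + v 0 * b w + v 1 * w 0]

section three

variable {F : Type*} [Field F] {a b : (Fin 3 → F) → F}

/-- The displayed vector is the commutator `k` of `v = (x, 0, 0)` and `w`, determined by `v ∘ w = (k
∘ w) ∘ v`. -/
theorem circThree_conj (ha : ∀ v w, a (circThree a b v w) = a v + a w)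
    (hb : ∀ v w, b (circThree a b v w) = b v + b w + a v * w 0) (w : Fin 3 → F) (hw : w 0 = 0)
    (x : F) :
    a ![0, x * a w, x * b w - x * w 1 - x ^ 2 * a w] = 0 ∧
      b ![0, x * a w, x * b w - x * w 1 - x ^ 2 * a w] = - (x * a w) := by
  set k : Fin 3 → F := ![0, x * a w, x * b w - x * w 1 - x ^ 2 * a w] with hk
  set v : Fin 3 → F := ![x, 0, 0] with hv
  have h : circThree a b v w = circThree a b (circThree a b k w) v := by
    funext i
    fin_cases i <;> simp [circThree, hk, hv, hw] <;> ring
  have h1 := congrArg a h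
  have h2 := congrArg b h
  have hk0 : k 0 = 0 := rfl
  have hv0 : v 0 = x := rfl
  simp only [ha, hb, hw, hv0] at h1 h2
  have h3 : a k = 0 := by linear_combination -h1
  refine ⟨h3, ?_⟩
  rw [h3] at h2
  linear_combination -h2

/-- The commutator of `(x, 0, 0)` with `(0, 0, t)` has linear part determined by `x s`, where `s = a
(0, 0, t)`. By injectivity `x s` also determines its last coordinate, so `eq_of_quadratic_graph`
makes `s` the same for all `t ≠ 0`. But `s` is additive in `t` and nonzero for `t ≠ 0`. -/
theorem circThree_false (ha : ∀ v w, a (circThree a b v w) = a v + a w)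
    (hb : ∀ v w, b (circThree a b v w) = b v + b w + a v * w 0)
    (hinj : ∀ v w, v 0 = w 0 → a v = a w → b v = b w → v = w) {y : F} (hy0 : y ≠ 0)
    (hy1 : y ≠ 1) : False := by
  have h00 : a 0 = 0 ∧ b 0 = 0 := by
    have h : circThree a b 0 0 = 0 := by
      funext i
      fin_cases i <;> simp [circThree]
    have h1 := ha 0 0
    have h2 := hb 0 0
    rw [h] at h1 h2
    simp only [Pi.zero_apply, mul_zero, add_zero] at h1 h2
    exact ⟨by linear_combination -h1, by linear_combination -h2⟩
  have hker : ∀ w : Fin 3 → F, w 0 = 0 → a w = 0 → b w = w 1 := by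
    intro w hw haw
    obtain ⟨h1, h2⟩ := circThree_conj ha hb w hw 1
    have := hinj _ 0 (by simp) (h1.trans h00.1.symm) (h2.trans (by rw [haw, h00.2]; simp))
    have := congrFun this 2
    simp [haw] at this
    linear_combination this
  have h2a : ∀ w : Fin 3 → F, w 0 = 0 → 2 * a w = 0 := by
    intro w hw
    obtain ⟨h1, h2⟩ := circThree_conj ha hb w hw 1
    have := hker _ (by simp) h1
    rw [h2] at this
    simp at this
    linear_combination -this
  have hne : ∀ t : F, t ≠ 0 → a ![0, 0, t] ≠ 0 := by
    intro t ht h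
    have := hker ![0, 0, t] (by simp) h
    have := hinj _ 0 (by simp) (h.trans h00.1.symm) (this.trans h00.2.symm)
    exact ht (by simpa using congrFun this 2)
  have hs : ∀ t t' : F, t ≠ 0 → t' ≠ 0 → a ![0, 0, t] = a ![0, 0, t'] := by
    intro t t' ht ht'
    refine eq_of_quadratic_graph (hne t ht) (hne t' ht') hy0 hy1 (g := b ![0, 0, t])
      (g' := b ![0, 0, t']) fun x x' hxx => ?_
    obtain ⟨h1, h2⟩ := circThree_conj ha hb ![0, 0, t] (by simp) x
    obtain ⟨h1', h2'⟩ := circThree_conj ha hb ![0, 0, t'] (by simp) x'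
    have := congrFun (hinj _ _ (by simp) (h1.trans h1'.symm)
      (h2.trans ((congrArg _ hxx).trans h2'.symm))) 2
    simpa using this
  have h1 := hs (y - 1) y (sub_ne_zero.2 hy1) hy0
  have h2 : circThree a b ![0, 0, y - 1] ![0, 0, 1] = ![0, 0, y] := by
    funext i
    fin_cases i <;> simp [circThree]
  have h3 := ha ![0, 0, y - 1] ![0, 0, 1]
  rw [h2, h1] at h3
  exact hne 1 one_ne_zero (by linear_combination -h3)

end three

/-! ### Dimension four in coordinates, characteristic two -/

/-- The product of a four-dimensional regular subgroup whose elements have linear parts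
`(1, a, b, c; 0, 1, d, e; 0, 0, 1, v 0; 0, 0, 0, 1)`. -/
def circFour {F : Type*} [Field F] (a b c d e : (Fin 4 → F) → F) (v w : Fin 4 → F) : Fin 4 → F :=
  ![v 0 + w 0, v 1 + w 1 + v 0 * a w, v 2 + w 2 + v 0 * b w + v 1 * d w,
    v 3 + w 3 + v 0 * c w + v 1 * e w + v 2 * w 0]

/-- The linear parts `(1, a, b, c; 0, 1, d, e; 0, 0, 1, v 0; 0, 0, 0, 1)` define a faithful
representation of a regular subgroup. -/
structure IsFaithfulFour {F : Type*} [Field F] (a b c d e : (Fin 4 → F) → F) : Prop where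
  map_a : ∀ v w, a (circFour a b c d e v w) = a v + a w
  map_b : ∀ v w, b (circFour a b c d e v w) = b v + b w + a v * d w
  map_c : ∀ v w, c (circFour a b c d e v w) = c v + c w + a v * e w + b v * w 0
  map_d : ∀ v w, d (circFour a b c d e v w) = d v + d w
  map_e : ∀ v w, e (circFour a b c d e v w) = e v + e w + d v * w 0
  inj : ∀ v w, v 0 = w 0 → a v = a w → b v = b w → c v = c w → d v = d w → e v = e w → v = w

namespace IsFaithfulFour

variable {F : Type*} [Field F] {a b c d e : (Fin 4 → F) → F}

theorem map_zero (h : IsFaithfulFour a b c d e) :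
    a 0 = 0 ∧ b 0 = 0 ∧ c 0 = 0 ∧ d 0 = 0 ∧ e 0 = 0 := by
  have h0 : circFour a b c d e 0 0 = 0 := by
    funext i
    fin_cases i <;> simp [circFour]
  have ha := h.map_a 0 0
  have hb := h.map_b 0 0
  have hc := h.map_c 0 0
  have hd := h.map_d 0 0
  have he := h.map_e 0 0
  rw [h0] at ha hb hc hd he
  simp only [Pi.zero_apply, mul_zero, add_zero, left_eq_add] at ha hd he
  simp only [ha, he, Pi.zero_apply, mul_zero, zero_mul, add_zero, left_eq_add] at hb hc
  exact ⟨ha, hb, hc, hd, he⟩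

theorem eq_zero (h : IsFaithfulFour a b c d e) {v : Fin 4 → F} (h0 : v 0 = 0) (ha : a v = 0)
    (hb : b v = 0) (hc : c v = 0) (hd : d v = 0) (he : e v = 0) : v = 0 := by
  obtain ⟨ha0, hb0, hc0, hd0, he0⟩ := h.map_zero
  exact h.inj v 0 h0 (ha.trans ha0.symm) (hb.trans hb0.symm) (hc.trans hc0.symm)
    (hd.trans hd0.symm) (he.trans he0.symm)

/-- Here `w'` is the conjugate of `w` by `v`, defined by `v ∘ w = w' ∘ v`. -/
theorem exists_conj (h : IsFaithfulFour a b c d e) (v w : Fin 4 → F) (hw : w 0 = 0) :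
    ∃ w' : Fin 4 → F, w' 0 = 0 ∧ w' 1 = w 1 + v 0 * a w ∧
      w' 2 = w 2 + v 0 * b w + v 1 * d w - w' 1 * d v ∧
      w' 3 = w 3 + v 0 * c w + v 1 * e w - w' 1 * e v - w' 2 * v 0 ∧
      a w' = a w ∧ d w' = d w ∧ e w' = e w - v 0 * d w ∧
      b w' = b w + a v * d w - a w * d v ∧
      c w' = c w + a v * e w - a w * e v - v 0 * b w' := by
  obtain ⟨w', h0, h1, h2, h3⟩ : ∃ w' : Fin 4 → F, w' 0 = 0 ∧ w' 1 = w 1 + v 0 * a w ∧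
      w' 2 = w 2 + v 0 * b w + v 1 * d w - w' 1 * d v ∧
      w' 3 = w 3 + v 0 * c w + v 1 * e w - w' 1 * e v - w' 2 * v 0 :=
    ⟨![0, w 1 + v 0 * a w, w 2 + v 0 * b w + v 1 * d w - (w 1 + v 0 * a w) * d v,
      w 3 + v 0 * c w + v 1 * e w - (w 1 + v 0 * a w) * e v -
        (w 2 + v 0 * b w + v 1 * d w - (w 1 + v 0 * a w) * d v) * v 0], rfl, rfl, rfl, rfl⟩
  have heq : circFour a b c d e v w = circFour a b c d e w' v := by
    funext i
    fin_cases i <;> simp [circFour, hw, h0, h1, h2, h3] <;> ring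
  have ka := congrArg a heq
  have kb := congrArg b heq
  have kc := congrArg c heq
  have kd := congrArg d heq
  have ke := congrArg e heq
  simp only [h.map_a, h.map_b, h.map_c, h.map_d, h.map_e, hw] at ka kb kc kd ke
  have ja : a w' = a w := by linear_combination -ka
  have jd : d w' = d w := by linear_combination -kd
  rw [ja] at kb kc
  rw [jd] at ke
  exact ⟨w', h0, h1, h2, h3, ja, jd, by linear_combination -ke, by linear_combination -kb,
    by linear_combination -kc⟩

/-- Here `k` solves `k ∘ w = w'`; with `w'` a conjugate of `w` it is a commutator. -/
theorem exists_quotient (h : IsFaithfulFour a b c d e) (w w' : Fin 4 → F) (hw : w 0 = 0)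
    (hw' : w' 0 = 0) :
    ∃ k : Fin 4 → F, k 0 = 0 ∧ k 1 = w' 1 - w 1 ∧ k 2 = w' 2 - w 2 - k 1 * d w ∧
      k 3 = w' 3 - w 3 - k 1 * e w ∧ a k = a w' - a w ∧ d k = d w' - d w ∧ e k = e w' - e w ∧
      b k = b w' - b w - a k * d w ∧ c k = c w' - c w - a k * e w := by
  obtain ⟨k, h0, h1, h2, h3⟩ : ∃ k : Fin 4 → F, k 0 = 0 ∧ k 1 = w' 1 - w 1 ∧
      k 2 = w' 2 - w 2 - k 1 * d w ∧ k 3 = w' 3 - w 3 - k 1 * e w :=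
    ⟨![0, w' 1 - w 1, w' 2 - w 2 - (w' 1 - w 1) * d w, w' 3 - w 3 - (w' 1 - w 1) * e w],
      rfl, rfl, rfl, rfl⟩
  have heq : circFour a b c d e k w = w' := by
    funext i
    fin_cases i <;> simp [circFour, hw, h0, h1, h2, h3, hw'] <;> ring
  have ka := congrArg a heq
  have kb := congrArg b heq
  have kc := congrArg c heq
  have kd := congrArg d heq
  have ke := congrArg e heq
  simp only [h.map_a, h.map_b, h.map_c, h.map_d, h.map_e, hw] at ka kb kc kd ke
  exact ⟨k, h0, h1, h2, h3, by linear_combination ka, by linear_combination kd,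
    by linear_combination ke, by linear_combination kb, by linear_combination kc⟩

/-- The elements whose linear part differs from `1` only in the corner are central. -/
theorem central (h : IsFaithfulFour a b c d e) {m : Fin 4 → F} (h0 : m 0 = 0) (ha : a m = 0)
    (hb : b m = 0) (hd : d m = 0) (he : e m = 0) (v : Fin 4 → F) :
    m 1 * d v = 0 ∧ v 0 * c m = m 1 * e v + m 2 * v 0 := by
  obtain ⟨m', h0', h1', h2', h3', ha', hd', he', hb', hc'⟩ := h.exists_conj v m h0
  rw [ha] at h1' ha' hb' hc'
  rw [hb] at h2' hb'
  rw [hd] at h2' hd' he' hb'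
  rw [he] at h3' he' hc'
  obtain rfl : m' = m := h.inj _ _ (h0'.trans h0.symm) (ha'.trans ha.symm)
    (by rw [hb', hb]; ring) (by rw [hc', hb']; ring) (hd'.trans hd.symm) (by rw [he', he]; ring)
  exact ⟨by linear_combination h2', by linear_combination -h3'⟩

section charTwo

variable (h2 : (2 : F) = 0)
include h2

/-- If `v 0 * d v ≠ 0`, commutators with `v` push elements with `w 0 = 0` towards the centre.
Feeding each vanishing statement back into the next commutator, together with `w ∘ w = 0` when `a w
= 0`, shows that `d w = 0` forces `w 1 = 0` and that `a w` always vanishes. The vector `(0, 1, 0,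
0)` then contradicts itself. -/
theorem mul_d_eq_zero (h : IsFaithfulFour a b c d e) (v : Fin 4 → F) : v 0 * d v = 0 := by
  by_contra hv
  have hv0 : v 0 ≠ 0 := left_ne_zero_of_mul hv
  have hvd : d v ≠ 0 := right_ne_zero_of_mul hv
  have step1 : ∀ k : Fin 4 → F, k 0 = 0 → a k = 0 → d k = 0 → e k = 0 → k 1 = 0 := by
    intro k h0 ha hd he
    obtain ⟨k', h0', h1', h2', h3', ha', hd', he', hb', hc'⟩ := h.exists_conj v k h0
    obtain ⟨q, q0, q1, q2, q3, qa, qd, qe, qb, qc⟩ := h.exists_quotient k k' h0 h0'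
    rw [ha'] at qa
    simp only [ha, hd, he, sub_self, mul_zero, zero_mul, add_zero, sub_zero] at h1' h2' he' hb' hc' qa qb qc q2 qd qe hd'
    have := (h.central q0 qa (by rw [qb, hb', sub_self]) (by rw [qd, hd']) (by rw [qe, he']) v).2
    rw [qc, hc', q1, q2, h2', h1', hb'] at this
    have h4 : v 0 * d v * k 1 = 0 := by
      linear_combination this + v 0 ^ 2 * b k * h2
    exact (mul_eq_zero.1 h4).resolve_left hv
  have step2 : ∀ w : Fin 4 → F, w 0 = 0 → d w = 0 → a w = 0 := by
    intro w h0 hd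
    obtain ⟨w', h0', h1', -, -, ha', hd', he', -, -⟩ := h.exists_conj v w h0
    obtain ⟨q, q0, q1, q2, q3, qa, qd, qe, qb, qc⟩ := h.exists_quotient w w' h0 h0'
    have := step1 q q0 (by rw [qa, ha', sub_self]) (by rw [qd, hd', sub_self])
      (by rw [qe, he', hd]; ring)
    rw [q1, h1'] at this
    exact (mul_eq_zero.1 (show v 0 * a w = 0 by linear_combination this)).resolve_left hv0
  have square : ∀ w : Fin 4 → F, w 0 = 0 → a w = 0 → w 1 * d w = 0 ∧ w 1 * e w = 0 := by
    intro w h0 ha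
    have hz := h.eq_zero (v := circFour a b c d e w w) (by simp [circFour, h0])
      (by rw [h.map_a, ha, add_zero])
      (by rw [h.map_b, ha]; linear_combination b w * h2)
      (by rw [h.map_c, ha, h0]; linear_combination c w * h2)
      (by rw [h.map_d]; linear_combination d w * h2)
      (by rw [h.map_e, h0]; linear_combination e w * h2)
    have i2 := congrFun hz 2
    have i3 := congrFun hz 3
    simp [circFour, h0] at i2 i3
    exact ⟨by linear_combination i2 - w 2 * h2, by linear_combination i3 - w 3 * h2⟩
  have step3 : ∀ w : Fin 4 → F, w 0 = 0 → d w = 0 → w 1 = 0 := by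
    intro w h0 hd
    have ha := step2 w h0 hd
    by_contra h1
    exact h1 (step1 w h0 ha hd (((mul_eq_zero.1 (square w h0 ha).2)).resolve_left h1))
  have step4 : ∀ w : Fin 4 → F, w 0 = 0 → a w = 0 := by
    intro w h0
    obtain ⟨w', h0', h1', -, -, ha', hd', he', -, -⟩ := h.exists_conj v w h0
    obtain ⟨q, q0, q1, q2, q3, qa, qd, qe, qb, qc⟩ := h.exists_quotient w w' h0 h0'
    have := step3 q q0 (by rw [qd, hd', sub_self])
    rw [q1, h1'] at this
    exact (mul_eq_zero.1 (show v 0 * a w = 0 by linear_combination this)).resolve_left hv0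
  have h5 := (square ![0, 1, 0, 0] rfl (step4 _ rfl)).1
  have h6 := step3 ![0, 1, 0, 0] rfl (by simpa using h5)
  simp at h6

/-- `d` is additive, so an element with `v 0 = 0` can be multiplied by `(1, 0, 0, 0)` to make `v 0`
nonzero. -/
theorem d_eq_zero (h : IsFaithfulFour a b c d e) (v : Fin 4 → F) : d v = 0 := by
  by_cases h0 : v 0 = 0
  · have h1 := h.mul_d_eq_zero h2 ![1, 0, 0, 0]
    have h3 := h.mul_d_eq_zero h2 (circFour a b c d e v ![1, 0, 0, 0])
    rw [h.map_d] at h3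
    simp [circFour, h0] at h1 h3
    rwa [h1, add_zero] at h3
  · exact (mul_eq_zero.1 (h.mul_d_eq_zero h2 v)).resolve_left h0

/-- In characteristic two, with `d = 0`, the linear part of `v ∘ v` is trivial outside the corner,
so `central` applies to it. -/
theorem square (h : IsFaithfulFour a b c d e) (v v' : Fin 4 → F) :
    v' 0 * (a v * e v) = v 0 * a v * e v' := by
  have hd := h.d_eq_zero h2
  have := (h.central (m := circFour a b c d e v v) (by simp [circFour]; linear_combination v 0 * h2)
    (by rw [h.map_a]; linear_combination a v * h2)
    (by rw [h.map_b, hd]; linear_combination b v * h2) (hd _)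
    (by rw [h.map_e, hd]; linear_combination e v * h2) v').2
  rw [h.map_c] at this
  simp [circFour, hd] at this
  linear_combination this - v' 0 * c v * h2 + (v 1 * e v' + v 2 * v' 0) * h2

theorem a_eq_zero_or (h : IsFaithfulFour a b c d e) :
    (∀ v, a v = 0) ∨ ∃ t, ∀ v, e v = t * v 0 := by
  by_cases hex : ∃ v : Fin 4 → F, v 0 * a v ≠ 0
  · obtain ⟨v, hv⟩ := hex
    have hv0 : v 0 ≠ 0 := left_ne_zero_of_mul hv
    refine Or.inr ⟨e v / v 0, fun w => mul_left_cancel₀ hv ?_⟩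
    rw [← h.square h2 v w]
    field_simp
  · push Not at hex
    refine Or.inl fun v => ?_
    by_cases h0 : v 0 = 0
    · have h1 := hex ![1, 0, 0, 0]
      have h3 := hex (circFour a b c d e v ![1, 0, 0, 0])
      rw [h.map_a] at h3
      simp [circFour, h0] at h1 h3
      rwa [h1, add_zero] at h3
    · exact (mul_eq_zero.1 (hex v)).resolve_left h0

/-- When `a = 0`, every `w` with `w 0 = 0` satisfies `w ∘ w = 0`, whence `w 1 * e w = 0`; additivity
of `e` on these elements removes the factor `w 1`. -/
theorem e_eq_zero (h : IsFaithfulFour a b c d e) {w : Fin 4 → F} (hw : w 0 = 0) : e w = 0 := by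
  obtain ha | ⟨t, ht⟩ := h.a_eq_zero_or h2
  · have hd := h.d_eq_zero h2
    have key : ∀ w : Fin 4 → F, w 0 = 0 → w 1 * e w = 0 := by
      intro w h0
      have hz := h.eq_zero (v := circFour a b c d e w w) (by simp [circFour, h0]) (ha _)
        (by rw [h.map_b, ha]; linear_combination b w * h2)
        (by rw [h.map_c, ha, h0]; linear_combination c w * h2) (hd _)
        (by rw [h.map_e, h0]; linear_combination e w * h2)
      have i3 := congrFun hz 3
      simp [circFour, h0] at i3
      linear_combination i3 - w 3 * h2
    by_cases h1 : w 1 = 0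
    · have k1 := key ![0, 1, 0, 0] rfl
      have k2 := key (circFour a b c d e w ![0, 1, 0, 0]) (by simp [circFour, hw])
      rw [h.map_e] at k2
      simp [circFour, hw, h1] at k1 k2
      rwa [k1, add_zero] at k2
    · exact (mul_eq_zero.1 (key w hw)).resolve_left h1
  · rw [ht, hw, mul_zero]

/-- The commutator of `(x, 0, 0, 0)` with an element `w` of the subgroup `w 0 = 0`. -/
theorem exists_commutator (h : IsFaithfulFour a b c d e) (x : F) {w : Fin 4 → F} (hw : w 0 = 0) :
    ∃ k : Fin 4 → F, k 0 = 0 ∧ k 1 = x * a w ∧ k 2 = x * b w ∧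
      k 3 = x * c w - (w 1 + x * a w) * e ![x, 0, 0, 0] - (w 2 + x * b w) * x ∧
      a k = 0 ∧ b k = 0 ∧ d k = 0 ∧ e k = 0 := by
  have hd := h.d_eq_zero h2
  obtain ⟨w', h0', h1', h2', h3', ha', hd', he', hb', hc'⟩ := h.exists_conj ![x, 0, 0, 0] w hw
  obtain ⟨k, k0, k1, k2, k3, ka, kd, ke, kb, kc⟩ := h.exists_quotient w w' hw h0'
  simp only [hd, h.e_eq_zero h2 hw, h.e_eq_zero h2 h0', Matrix.cons_val_zero, Matrix.cons_val_one,
    mul_zero, add_zero, sub_zero, sub_self] at *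
  refine ⟨k, k0, by rw [k1, h1']; ring, by rw [k2, h2']; ring, ?_, by rw [ka, ha', sub_self],
    by rw [kb, hb', sub_self], trivial, ke⟩
  rw [k3, h3', h1', h2']
  ring

/-- On the elements with `w 0 = 0` and `w 1 * g + w 2 = 0`, the map `s = b + g a` is injective,
since `s` is the corner of a commutator with `(1, 0, 0, 0)` that has no other entry. If `|F| > 2`,
`eq_of_quadratic_graph` gives `(0, 0, 0, y)` and `(0, 0, 0, 1)` the same `s`. If `|F| = 2`, `(0, 0,
0, 1)` and `(0, 1, -g, 0)` both have the only nonzero value. -/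
theorem false (h : IsFaithfulFour a b c d e) : False := by
  have hd := h.d_eq_zero h2
  set g := e ![1, 0, 0, 0] with hg
  have hae : ∀ w x, a w * e ![x, 0, 0, 0] = a w * (g * x) := by
    intro w x
    obtain ha | ⟨t, ht⟩ := h.a_eq_zero_or h2
    · rw [ha, zero_mul, zero_mul]
    · rw [hg, ht, ht]; simp
  have hcm : ∀ m : Fin 4 → F, m 0 = 0 → a m = 0 → b m = 0 → c m = m 1 * g + m 2 := by
    intro m h0 ha hb
    have := (h.central h0 ha hb (hd m) (h.e_eq_zero h2 h0) ![1, 0, 0, 0]).2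
    simpa [hg] using this
  have hs0 : ∀ w : Fin 4 → F, w 0 = 0 → w 1 * g + w 2 = 0 → b w + g * a w = 0 → w = 0 := by
    intro w h0 hw hs
    obtain ⟨k, k0, k1, k2, -, ka, kb, kd, ke⟩ := h.exists_commutator h2 1 h0
    have hk : k = 0 := h.eq_zero k0 ka kb
      (by rw [hcm k k0 ka kb, k1, k2]; linear_combination hs) kd ke
    have ha : a w = 0 := by simpa [hk] using k1.symm
    have hb : b w = 0 := by simpa [hk] using k2.symm
    exact h.eq_zero h0 ha hb ((hcm w h0 ha hb).trans hw) (hd w) (h.e_eq_zero h2 h0)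
  have hinj : ∀ w w' : Fin 4 → F, w 0 = 0 → w' 0 = 0 → w 1 * g + w 2 = 0 →
      w' 1 * g + w' 2 = 0 → b w + g * a w = b w' + g * a w' → w = w' := by
    intro w w' h0 h0' hw hw' hs
    obtain ⟨k, k0, k1, k2, k3, ka, kd, ke, kb, kc⟩ := h.exists_quotient w w' h0 h0'
    rw [hd, mul_zero, sub_zero] at k2 kb
    rw [h.e_eq_zero h2 h0, mul_zero, sub_zero] at k3
    have hk := hs0 k k0 (by rw [k1, k2]; linear_combination hw' - hw)
      (by rw [ka, kb]; linear_combination -hs)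
    rw [hk, Pi.zero_apply] at k1 k2 k3
    funext i
    fin_cases i
    · exact h0.trans h0'.symm
    · exact (sub_eq_zero.1 k1.symm).symm
    · exact (sub_eq_zero.1 k2.symm).symm
    · exact (sub_eq_zero.1 k3.symm).symm
  have hne : ∀ t : F, t ≠ 0 → b ![0, 0, 0, t] + g * a ![0, 0, 0, t] ≠ 0 := fun t ht h' =>
    ht (by simpa using congrFun (hs0 ![0, 0, 0, t] rfl (by simp) h') 3)
  by_cases hy : ∃ y : F, y ≠ 0 ∧ y ≠ 1
  · obtain ⟨y, hy0, hy1⟩ := hy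
    have hs : b ![0, 0, 0, y] + g * a ![0, 0, 0, y] = b ![0, 0, 0, 1] + g * a ![0, 0, 0, 1] := by
      refine eq_of_quadratic_graph (hne y hy0) (hne 1 one_ne_zero) hy0 hy1
        (g := c ![0, 0, 0, y]) (g' := c ![0, 0, 0, 1]) fun x x' hxx => ?_
      obtain ⟨k, k0, k1, k2, k3, ka, kb, kd, ke⟩ :=
        h.exists_commutator h2 x (w := ![0, 0, 0, y]) rfl
      obtain ⟨k', k0', k1', k2', k3', ka', kb', kd', ke'⟩ :=
        h.exists_commutator h2 x' (w := ![0, 0, 0, 1]) rfl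
      have hkk : k = k' := h.inj _ _ (k0.trans k0'.symm) (ka.trans ka'.symm) (kb.trans kb'.symm)
        (by rw [hcm k k0 ka kb, hcm k' k0' ka' kb', k1, k2, k1', k2']; linear_combination hxx)
        (kd.trans kd'.symm) (ke.trans ke'.symm)
      rw [hkk, k3'] at k3
      simp only [Matrix.cons_val_one, Matrix.cons_val, zero_add] at k3
      linear_combination -k3 + x * hae ![0, 0, 0, y] x - x' * hae ![0, 0, 0, 1] x'
    exact hy1 (by simpa using congrFun (hinj _ _ rfl rfl (by simp) (by simp) hs) 3)
  · push Not at hy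
    have h1 := hy _ (hne 1 one_ne_zero)
    have h3 : b ![0, 1, -g, 0] + g * a ![0, 1, -g, 0] ≠ 0 := fun h' => by
      simpa using congrFun (hs0 ![0, 1, -g, 0] rfl (by simp) h') 1
    have := congrFun (hinj ![0, 0, 0, 1] ![0, 1, -g, 0] rfl rfl (by simp) (by simp)
      (h1.trans (hy _ h3).symm)) 3
    simp at this

end charTwo

end IsFaithfulFour

/-! ### Adapted bases for regular subgroups in dimensions three and four -/

/-- A unipotent endomorphism acts with eigenvalue `1` modulo any invariant subspace. -/
theorem eq_one_of_apply_sub_smul_mem {F V : Type*} [Field F] [AddCommGroup V] [Module F V]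
    {T : End F V} (hT : IsNilpotent (T - 1)) {W : Submodule F V} (hW : ∀ x ∈ W, T x ∈ W) {x : V}
    (hx : x ∉ W) {c : F} (hc : T x - c • x ∈ W) : c = 1 := by
  obtain ⟨m, hm⟩ := hT
  have key : ∀ k : ℕ, ((T - 1) ^ k) x - (c - 1) ^ k • x ∈ W := by
    intro k
    induction k with
    | zero => simp
    | succ k ih =>
      have h1 : (T - 1) (((T - 1) ^ k) x - (c - 1) ^ k • x) ∈ W := W.sub_mem (hW _ ih) ih
      have h2 := W.add_mem h1 (W.smul_mem ((c - 1) ^ k) hc)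
      convert h2 using 1
      rw [pow_succ', Module.End.mul_apply, map_sub, map_smul]
      simp only [LinearMap.sub_apply, Module.End.one_apply, pow_succ']
      module
  have h := key m
  rw [hm, LinearMap.zero_apply, zero_sub, W.neg_mem_iff] at h
  by_contra hne
  exact hx ((W.smul_mem_iff (pow_ne_zero m (sub_ne_zero.2 hne))).1 h)

theorem linearIndependent_pair_of_notMem {F V : Type*} [Field F] [AddCommGroup V] [Module F V]
    {z u : V} (hu : u ≠ 0) (hz : z ∉ Submodule.span F {u}) : LinearIndependent F ![z, u] :=
  linearIndependent_finCons.2 ⟨by simpa [linearIndependent_unique_iff], by simpa using hz⟩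

theorem linearIndependent_cons_of_apply_eq_one {F V : Type*} [Field F] [AddCommGroup V]
    [Module F V] {n : ℕ} {v : Fin n → V} (hv : LinearIndependent F v) {f : V →ₗ[F] F} {e : V}
    (he : f e = 1) (hf : ∀ i, f (v i) = 0) :
    LinearIndependent F (Matrix.vecCons e v) := by
  refine linearIndependent_finCons.2 ⟨hv, fun h => ?_⟩
  have hle : Submodule.span F (Set.range v) ≤ LinearMap.ker f := by
    rw [Submodule.span_le]
    rintro _ ⟨i, rfl⟩
    exact hf i
  have h0 : f e = 0 := hle h
  exact one_ne_zero (he.symm.trans h0)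

namespace IsRegularFamily

variable {F V : Type*} [Field F] [AddCommGroup V] [Module F V] [FiniteDimensional F V]
  {A : V → End F V}

/-- The shape of a regular subgroup having a central commutator `z` whose linear part is a
transvection. -/
theorem exists_transvection (hA : IsRegularFamily A) (hT : IsTranslationFree A)
    (hU : ∀ a ∈ hA.toSubmonoid, IsNilpotent (a - 1)) {z v₀ w₀ : V} (hz1 : A z ≠ 1)
    (hz : ∀ x, A x * A z = A z * A x) (hz2 : (A z - 1) * (A z - 1) = 0)
    (hcomm : A (A v₀ w₀ + v₀) z + (A v₀ w₀ + v₀) = A w₀ v₀ + w₀)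
    (hrank : finrank F (LinearMap.range (A z - 1)) ≤ 1) :
    ∃ (f : V →ₗ[F] F) (u e : V), f e = 1 ∧ f z = 0 ∧ f u = 0 ∧ u ≠ 0 ∧
      z ∉ Submodule.span F {u} ∧ (∀ v, A v u = u) ∧ (∀ v x, f (A v x) = f x) ∧
      ∀ v, A v z = z + f v • u := by
  obtain ⟨e', he'⟩ : ∃ e, (A z - 1) e ≠ 0 := by
    by_contra! h
    exact hz1 (sub_eq_zero.1 (LinearMap.ext h))
  set N := A z - 1 with hN
  set u := N e' with hu
  have hmem : ∀ x, ∃ c : F, c • u = N x := by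
    intro x
    have hu0 : (⟨u, e', rfl⟩ : LinearMap.range N) ≠ 0 := fun h => he' (congrArg Subtype.val h)
    have h1 : finrank F (LinearMap.range N) = 1 := by
      have : 0 < finrank F (LinearMap.range N) := finrank_pos_iff_exists_ne_zero.2 ⟨_, hu0⟩
      omega
    obtain ⟨c, hc⟩ := (finrank_eq_one_iff_of_nonzero' _ hu0).1 h1 ⟨N x, x, rfl⟩
    exact ⟨c, congrArg Subtype.val hc⟩
  obtain ⟨g, hg⟩ := Module.Projective.exists_dual_eq_one F he'
  have hNf : ∀ x, N x = g (N x) • u := by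
    intro x
    obtain ⟨c, hc⟩ := hmem x
    rw [← hc, map_smul, hg, smul_eq_mul, mul_one]
  have hcomm' : ∀ v x, A v (N x) = N (A v x) := by
    intro v x
    have := LinearMap.congr_fun (hz v) x
    simp only [Module.End.mul_apply] at this
    simp [hN, this]
  have hAu : ∀ v, A v u = u := by
    intro v
    have h1 : A v u = g (N (A v e')) • u := (hcomm' v e').trans (hNf _)
    have := eq_one_of_apply_sub_smul_mem (hU _ (hA.mem_toSubmonoid v)) (W := ⊥) (x := u)
      (c := g (N (A v e'))) (by simp) (by simpa using he') (by rw [h1, sub_self]; exact zero_mem _)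
    rw [h1, this, one_smul]
  have hinv : ∀ v x, g (N (A v x)) = g (N x) := by
    intro v x
    rw [← hcomm', hNf x, map_smul, hAu]
  -- By faithfulness, `z` and `v` commute for the group law itself: `A z v + z = A v z + v`.
  have hAz : ∀ v, A v z = z + g (N v) • u := by
    intro v
    have h1 : A z v + z = A v z + v :=
      hA.injective hT (by rw [hA.map_circ, hA.map_circ, hz])
    rw [← hNf, hN, LinearMap.sub_apply, Module.End.one_apply, eq_sub_of_add_eq h1.symm]
    abel
  -- The functional `g ∘ N` is invariant, hence additive for the group law, so it kills the
  -- commutator `z`.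
  have hz0 : g (N z) = 0 := by
    have := congrArg (fun x => g (N x)) hcomm
    simp only [map_add, hinv] at this
    linear_combination this
  refine ⟨g ∘ₗ N, u, e', hg, hz0, ?_, he', fun h => ?_, hAu, hinv, hAz⟩
  · have := LinearMap.congr_fun hz2 e'
    rw [LinearMap.comp_apply, hu]
    exact (congrArg g this).trans (_root_.map_zero g)
  · obtain ⟨c, hc⟩ := Submodule.mem_span_singleton.1 h
    have h1 := hAz e'
    rw [← hu, hg, one_smul, ← hc, map_smul, hAu] at h1
    exact he' (left_eq_add.1 h1)

/-- A translation-free regular subgroup of the affine group of dimension three exists over the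
field of two elements only. -/
theorem false_of_finrank_eq_three (hA : IsRegularFamily A) (hT : IsTranslationFree A)
    (hU : ∀ a ∈ hA.toSubmonoid, IsNilpotent (a - 1)) (h3 : finrank F V = 3) {y : F} (hy0 : y ≠ 0)
    (hy1 : y ≠ 1) : False := by
  have : Nontrivial V := nontrivial_of_finrank_pos (R := F) (by omega)
  obtain ⟨z, v₀, w₀, hz1, hz, hz2, hcomm⟩ := hA.exists_central hT hU (by omega)
  have hrank : finrank F (LinearMap.range (A z - 1)) ≤ 1 := by
    have h1 : LinearMap.range (A z - 1) ≤ LinearMap.ker (A z - 1) := by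
      rintro _ ⟨x, rfl⟩
      exact LinearMap.congr_fun hz2 x
    have := Submodule.finrank_mono h1
    have := LinearMap.finrank_range_add_finrank_ker (A z - 1)
    omega
  obtain ⟨f, u, e, he, hfz, hfu, hu, hzu, hAu, hf, hAz⟩ :=
    hA.exists_transvection hT hU hz1 hz hz2 hcomm hrank
  have hli : LinearIndependent F ![e, z, u] :=
    linearIndependent_cons_of_apply_eq_one (linearIndependent_pair_of_notMem hu hzu) he (by
      intro i
      fin_cases i <;> simpa)
  let B := basisOfLinearIndependentOfCardEqFinrank hli (by simp [h3])
  have hB0 : B 0 = e := by simp [B]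
  have hB1 : B 1 = z := by simp [B]
  have hB2 : B 2 = u := by simp [B]
  set E := B.equivFun.symm with hE
  have hEv : ∀ v, E v = v 0 • e + v 1 • z + v 2 • u := by
    intro v
    simp [hE, Basis.equivFun_symm_apply, Fin.sum_univ_three, hB0, hB1, hB2]
  have hrepr : ∀ x, x = f x • e + B.equivFun x 1 • z + B.equivFun x 2 • u := by
    intro x
    have h := hEv (B.equivFun x)
    rw [hE, LinearEquiv.symm_apply_apply] at h
    have h0 : f x = B.equivFun x 0 := by
      conv_lhs => rw [h]
      simp [he, hfz, hfu]
    rw [h0]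
    exact h
  set a : (Fin 3 → F) → F := fun v => B.equivFun (A (E v) e) 1 with ha
  set b : (Fin 3 → F) → F := fun v => B.equivFun (A (E v) e) 2 with hb
  have hfE : ∀ v, f (E v) = v 0 := by
    intro v
    simp [hEv, he, hfz, hfu]
  have hAe : ∀ v, A (E v) e = e + a v • z + b v • u := by
    intro v
    conv_lhs => rw [hrepr (A (E v) e), hf, he, one_smul]
  have hcirc : ∀ v w, E (circThree a b v w) = A (E w) (E v) + E w := by
    intro v w
    rw [hEv v]
    simp only [map_add, map_smul, hAe, hAz, hAu, hfE]
    rw [hEv w, hEv]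
    simp only [circThree, Matrix.cons_val]
    module
  have hprod : ∀ v w, A (E (circThree a b v w)) e =
      E ![1, a v + a w, b v + b w + a v * w 0] := by
    intro v w
    rw [hcirc, hA.map_circ, Module.End.mul_apply, hAe v]
    simp only [map_add, map_smul, hAe, hAz, hAu, hfE]
    rw [hEv]
    simp only [Matrix.cons_val]
    module
  have hBE : ∀ v, B.equivFun (E v) = v := fun v => B.equivFun.apply_symm_apply v
  refine circThree_false (a := a) (b := b) (fun v w => ?_) (fun v w => ?_)
    (fun v w h0 h1 h2 => ?_) hy0 hy1
  · exact congrFun ((congrArg B.equivFun (hprod v w)).trans (hBE _)) 1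
  · exact congrFun ((congrArg B.equivFun (hprod v w)).trans (hBE _)) 2
  · refine E.injective (hA.injective hT (B.ext fun i => ?_))
    fin_cases i
    · simp [hB0, hAe, h1, h2]
    · simp [hB1, hAz, hfE, h0]
    · simp [hB2, hAu]

/-- There is no translation-free regular subgroup of the affine group of dimension four in
characteristic two. -/
theorem false_of_finrank_eq_four (hA : IsRegularFamily A) (hT : IsTranslationFree A)
    (hU : ∀ a ∈ hA.toSubmonoid, IsNilpotent (a - 1)) (h4 : finrank F V = 4)
    (htwo : (2 : F) = 0) : False := by
  have : Nontrivial V := nontrivial_of_finrank_pos (R := F) (by omega)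
  obtain ⟨z, v₀, w₀, hz1, hz, hz2, hcomm⟩ := hA.exists_central hT hU (by omega)
  -- Rank two, with range equal to kernel, has to be excluded. In characteristic two `A z` squares
  -- to `1`, so `z ∘ z = 0`, which puts `z` in the kernel. The range consists of the vectors `A v z
  -- - z`, so it lies in the displacement of the kernel, a proper subspace of it.
  have hrank : finrank F (LinearMap.range (A z - 1)) ≤ 1 := by
    set N := A z - 1 with hN
    have hNv : ∀ v, N v = A v z - z := by
      intro v
      have h1 : A z v + z = A v z + v :=
        hA.injective hT (by rw [hA.map_circ, hA.map_circ, hz])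
      rw [hN, LinearMap.sub_apply, Module.End.one_apply, eq_sub_of_add_eq h1]
      abel
    have h1 : LinearMap.range N ≤ LinearMap.ker N := by
      rintro _ ⟨x, rfl⟩
      exact LinearMap.congr_fun hz2 x
    have htwoV : ∀ x : V, x + x = 0 := fun x => by rw [← two_smul F, htwo, zero_smul]
    have hzker : z ∈ LinearMap.ker N := by
      have hzz : A z z + z = 0 := hT _ (by
        rw [hA.map_circ]
        have h3 : A z * A z = N * N + (A z + A z) - 1 := by rw [hN]; noncomm_ring
        have h5 : A z + A z = 0 := LinearMap.ext fun x => htwoV (A z x)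
        rw [h3, hz2, h5]
        ext x
        simpa using (eq_neg_of_add_eq_zero_left (htwoV x)).symm)
      rw [LinearMap.mem_ker, hN, LinearMap.sub_apply, Module.End.one_apply, ← hzz]
      rw [sub_eq_iff_eq_add, add_assoc, htwoV, add_zero]
    have hinv : ∀ a ∈ hA.toSubmonoid, ∀ x ∈ LinearMap.ker N, a x ∈ LinearMap.ker N := by
      rintro _ ⟨v, rfl⟩ x hx
      have h5 := LinearMap.congr_fun (hz v) x
      simp only [Module.End.mul_apply] at h5
      rw [LinearMap.mem_ker, hN, LinearMap.sub_apply, Module.End.one_apply, sub_eq_zero] at hx ⊢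
      rw [← h5, hx]
    have hne : LinearMap.ker N ≠ ⊥ := by
      intro h
      rw [h] at hzker
      exact hz1 (by rw [(Submodule.mem_bot F).1 hzker, hA.map_zero])
    have hle : LinearMap.range N ≤ hA.toSubmonoid.displacement (LinearMap.ker N) := by
      rintro _ ⟨x, rfl⟩
      rw [hNv]
      exact Submonoid.sub_mem_displacement (hA.mem_toSubmonoid x) hzker
    have h5 := Submodule.finrank_mono hle
    have h6 := Submodule.finrank_lt_finrank_of_lt (Submonoid.displacement_lt hU hinv hne)
    have := LinearMap.finrank_range_add_finrank_ker N
    omega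
  obtain ⟨f, u, e, he, hfz, hfu, hu, hzu, hAu, hf, hAz⟩ :=
    hA.exists_transvection hT hU hz1 hz hz2 hcomm hrank
  set W := Submodule.span F {z, u} with hW
  have hzW : z ∈ W := Submodule.subset_span (by simp)
  have huW : u ∈ W := Submodule.subset_span (by simp)
  obtain ⟨y, hfy, hyW⟩ : ∃ y, f y = 0 ∧ y ∉ W := by
    by_contra! h
    have h1 : LinearMap.ker f ≤ W := fun y hy => h y hy
    have h5 := Submodule.finrank_mono h1
    have h6 := LinearMap.finrank_range_add_finrank_ker f
    have h7 : finrank F (LinearMap.range f) ≤ 1 :=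
      (Submodule.finrank_le _).trans (finrank_self F).le
    have h8 : finrank F W ≤ 2 := by
      rw [hW, ← Matrix.range_cons_cons_empty z u ![]]
      exact (finrank_range_le_card _).trans (by simp)
    omega
  have hWinv : ∀ v, ∀ x ∈ W, A v x ∈ W := by
    intro v x hx
    obtain ⟨c, d, rfl⟩ := Submodule.mem_span_pair.1 hx
    rw [map_add, map_smul, map_smul, hAz, hAu]
    exact W.add_mem (W.smul_mem _ (W.add_mem hzW (W.smul_mem _ huW))) (W.smul_mem _ huW)
  have hli : LinearIndependent F ![e, y, z, u] := by
    refine linearIndependent_cons_of_apply_eq_one (linearIndependent_finCons.2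
      ⟨linearIndependent_pair_of_notMem hu hzu, by rwa [Matrix.range_cons_cons_empty]⟩) he (fun i => ?_)
    fin_cases i <;> simpa
  let B := basisOfLinearIndependentOfCardEqFinrank hli (by simp [h4])
  have hB0 : B 0 = e := by simp [B]
  have hB1 : B 1 = y := by simp [B]
  have hB2 : B 2 = z := by simp [B]
  have hB3 : B 3 = u := by simp [B]
  set E := B.equivFun.symm with hE
  have hEv : ∀ v, E v = v 0 • e + v 1 • y + v 2 • z + v 3 • u := by
    intro v
    simp [hE, Basis.equivFun_symm_apply, Fin.sum_univ_four, hB0, hB1, hB2, hB3]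
  have hrepr : ∀ x, x = f x • e + B.equivFun x 1 • y + B.equivFun x 2 • z +
      B.equivFun x 3 • u := by
    intro x
    have h := hEv (B.equivFun x)
    rw [hE, LinearEquiv.symm_apply_apply] at h
    have h0 : f x = B.equivFun x 0 := by
      conv_lhs => rw [h]
      simp [he, hfz, hfu, hfy]
    rw [h0]
    exact h
  set a : (Fin 4 → F) → F := fun v => B.equivFun (A (E v) e) 1 with ha
  set b : (Fin 4 → F) → F := fun v => B.equivFun (A (E v) e) 2 with hb
  set c : (Fin 4 → F) → F := fun v => B.equivFun (A (E v) e) 3 with hc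
  set d : (Fin 4 → F) → F := fun v => B.equivFun (A (E v) y) 2 with hd
  set e' : (Fin 4 → F) → F := fun v => B.equivFun (A (E v) y) 3 with he'
  have hfE : ∀ v, f (E v) = v 0 := by
    intro v
    simp [hEv, he, hfz, hfu, hfy]
  have hAe : ∀ v, A (E v) e = e + a v • y + b v • z + c v • u := by
    intro v
    conv_lhs => rw [hrepr (A (E v) e), hf, he, one_smul]
  have hAy : ∀ v, A (E v) y = y + d v • z + e' v • u := by
    intro v
    have h1 := hrepr (A (E v) y)
    rw [hf, hfy, zero_smul, zero_add] at h1
    have h5 : B.equivFun (A (E v) y) 1 = 1 := by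
      refine eq_one_of_apply_sub_smul_mem (hU _ (hA.mem_toSubmonoid (E v))) (hWinv _) hyW ?_
      rw [sub_eq_iff_eq_add'.2 (h1.trans (add_assoc _ _ _))]
      exact W.add_mem (W.smul_mem _ hzW) (W.smul_mem _ huW)
    rw [h5, one_smul] at h1
    exact h1
  have hcirc : ∀ v w, E (circFour a b c d e' v w) = A (E w) (E v) + E w := by
    intro v w
    rw [hEv v]
    simp only [map_add, map_smul, hAe, hAy, hAz, hAu, hfE]
    rw [hEv w, hEv]
    simp only [circFour, Matrix.cons_val]
    module
  have hprod : ∀ v w, A (E (circFour a b c d e' v w)) e =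
      E ![1, a v + a w, b v + b w + a v * d w, c v + c w + a v * e' w + b v * w 0] := by
    intro v w
    rw [hcirc, hA.map_circ, Module.End.mul_apply, hAe v]
    simp only [map_add, map_smul, hAe, hAy, hAz, hAu, hfE]
    rw [hEv]
    simp only [Matrix.cons_val]
    module
  have hprod' : ∀ v w, A (E (circFour a b c d e' v w)) y =
      E ![0, 1, d v + d w, e' v + e' w + d v * w 0] := by
    intro v w
    rw [hcirc, hA.map_circ, Module.End.mul_apply, hAy v]
    simp only [map_add, map_smul, hAy, hAz, hAu, hfE]
    rw [hEv]
    simp only [Matrix.cons_val]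
    module
  have hBE : ∀ v, B.equivFun (E v) = v := fun v => B.equivFun.apply_symm_apply v
  refine IsFaithfulFour.false htwo (a := a) (b := b) (c := c) (d := d) (e := e')
    ⟨fun v w => ?_, fun v w => ?_, fun v w => ?_, fun v w => ?_, fun v w => ?_,
      fun v w h0 h1 h2 h3 h5 h6 => ?_⟩
  · exact congrFun ((congrArg B.equivFun (hprod v w)).trans (hBE _)) 1
  · exact congrFun ((congrArg B.equivFun (hprod v w)).trans (hBE _)) 2
  · exact congrFun ((congrArg B.equivFun (hprod v w)).trans (hBE _)) 3
  · exact congrFun ((congrArg B.equivFun (hprod' v w)).trans (hBE _)) 2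
  · exact congrFun ((congrArg B.equivFun (hprod' v w)).trans (hBE _)) 3
  · refine E.injective (hA.injective hT (B.ext fun i => ?_))
    fin_cases i
    · simp [hB0, hAe, h1, h2, h3]
    · simp [hB1, hAy, h5, h6]
    · simp [hB2, hAz, hfE, h0]
    · simp [hB3, hAu]

end IsRegularFamily

/-! ### From matrix groups to families of linear parts -/

namespace AGL

/-- Translation-free regular subgroups of `AGL n F` correspond to families of linear parts. -/
theorem exists_isRegular_iff (n : ℕ) (F : Type*) [Field F] :
    (∃ R : Subgroup (AGL n F), AGL.IsRegular R ∧ R ⊓ AGL.translations n F = ⊥) ↔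
      ∃ A : (Fin n → F) → End F (Fin n → F), IsRegularFamily A ∧ IsTranslationFree A := by
  have htrans : ∀ g : AGL n F, g ∈ AGL.translations n F ↔
      ((g : GL (Unit ⊕ Fin n) F) : Matrix (Unit ⊕ Fin n) (Unit ⊕ Fin n) F).toBlocks₂₂ = 1 := by
    intro g
    rw [AGL.translations, MonoidHom.mem_ker, Units.ext_iff]
    rfl
  have hform : ∀ (g : AGL n F) (v : Fin n → F),
      ((g : GL (Unit ⊕ Fin n) F) : Matrix (Unit ⊕ Fin n) (Unit ⊕ Fin n) F) (Sum.inl ()) =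
        Sum.elim (fun _ => 1) v →
      ∃ M : GL (Fin n) F,
        ((g : GL (Unit ⊕ Fin n) F) : Matrix (Unit ⊕ Fin n) (Unit ⊕ Fin n) F) =
          Matrix.fromBlocks 1 (Matrix.replicateRow Unit v) 0 (M : Matrix (Fin n) (Fin n) F) := by
    rintro ⟨g, w, M, hg⟩ v hv
    refine ⟨M, ?_⟩
    obtain rfl : w = v := by
      funext i
      have := congrFun hv (Sum.inr i)
      simpa [hg] using this
    exact hg
  constructor
  · rintro ⟨R, hR, hRT⟩
    choose r hr huniq using hR
    choose M hM using fun v => hform (r v) v (hr v).2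
    have hmul : ∀ v w, ((r v * r w : AGL n F) : GL (Unit ⊕ Fin n) F).val =
        Matrix.fromBlocks 1 (Matrix.replicateRow Unit (Matrix.vecMul v (M w).val + w)) 0
          (M v * M w).val := by
      intro v w
      rw [Subgroup.coe_mul, Units.val_mul, hM, hM, Matrix.fromBlocks_multiply]
      simp [Matrix.replicateRow_vecMul, Matrix.replicateRow_add, add_comm]
    have hrmul : ∀ v w, r (Matrix.vecMul v (M w).val + w) = r v * r w := by
      intro v w
      refine (huniq _ _ ⟨R.mul_mem (hr v).1 (hr w).1, ?_⟩).symm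
      rw [hmul]
      funext i
      rcases i with i | i <;> simp
    have hMmul : ∀ v w, M (Matrix.vecMul v (M w).val + w) = M v * M w := by
      intro v w
      have h := hmul v w
      rw [← hrmul, hM] at h
      exact Units.ext (Matrix.fromBlocks_inj.1 h).2.2.2
    have hr1 : r 0 = 1 := by
      refine (huniq 0 1 ⟨R.one_mem, ?_⟩).symm
      funext i
      rcases i with i | i <;> simp
    have hM1 : M 0 = 1 := by
      have h := hM 0
      rw [hr1, OneMemClass.coe_one, Units.val_one, ← Matrix.fromBlocks_one] at h
      exact Units.ext (Matrix.fromBlocks_inj.1 h).2.2.2.symm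
    -- Matrices act on row vectors from the right, which reverses products; this matches the order
    -- in `map_circ`.
    have key : ∀ N N' : GL (Fin n) F, Matrix.toLinearMapRight' (N * N').val =
        (Matrix.toLinearMapRight' N'.val * Matrix.toLinearMapRight' N.val :
          End F (Fin n → F)) := fun N N' => by
      rw [Units.val_mul, Matrix.toLinearMapRight'_mul]
      rfl
    have key1 : (Matrix.toLinearMapRight' (1 : GL (Fin n) F).val : End F (Fin n → F)) = 1 := by
      rw [Units.val_one, Matrix.toLinearMapRight'_one]
      rfl
    refine ⟨fun v => Matrix.toLinearMapRight' (M v).val, ⟨?_, fun v w => ?_, fun v => ?_⟩,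
      fun v hv => ?_⟩
    · rw [hM1, key1]
    · rw [← key, ← hMmul]
      rfl
    · refine ⟨⟨_, Matrix.toLinearMapRight' (M v)⁻¹.val, ?_, ?_⟩, rfl⟩
      · rw [← key, inv_mul_cancel, key1]
      · rw [← key, mul_inv_cancel, key1]
    · rw [← key1] at hv
      have h1 : (M v).val = 1 := by
        simpa using Matrix.toLinearMapRight'.injective hv
      have h2 : r v ∈ R ⊓ AGL.translations n F := by
        refine ⟨(hr v).1, (htrans _).2 ?_⟩
        rw [hM, Matrix.toBlocks_fromBlocks₂₂, h1]
      rw [hRT, Subgroup.mem_bot] at h2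
      have h3 := hM v
      rw [h2, OneMemClass.coe_one, Units.val_one, ← Matrix.fromBlocks_one] at h3
      have h4 := (Matrix.fromBlocks_inj.1 h3).2.1
      funext i
      exact (congrFun (congrFun h4 ()) i).symm
  · rintro ⟨A, hA, hT⟩
    let N : (Fin n → F) → Matrix (Fin n) (Fin n) F := fun v => Matrix.toLinearMapRight'.symm (A v)
    have hN : ∀ v x, Matrix.vecMul x (N v) = A v x := by
      intro v x
      rw [← Matrix.toLinearMapRight'_apply, LinearEquiv.apply_symm_apply]
    have hN1 : N 0 = 1 := by
      refine Matrix.ext_iff_vecMul.2 fun x => ?_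
      rw [hN, hA.map_zero, Matrix.vecMul_one]
      rfl
    have hNmul : ∀ v w, N (A w v + w) = N v * N w := by
      intro v w
      refine Matrix.ext_iff_vecMul.2 fun x => ?_
      rw [hN, hA.map_circ, ← Matrix.vecMul_vecMul, hN, hN]
      rfl
    let P : (Fin n → F) → Matrix (Unit ⊕ Fin n) (Unit ⊕ Fin n) F := fun v =>
      Matrix.fromBlocks 1 (Matrix.replicateRow Unit v) 0 (N v)
    have hPmul : ∀ v w, P v * P w = P (A w v + w) := by
      intro v w
      simp only [P]
      rw [Matrix.fromBlocks_multiply, hNmul, ← hN w v]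
      simp [Matrix.replicateRow_vecMul, Matrix.replicateRow_add, add_comm]
    have hP1 : P 0 = 1 := by
      simp only [P]
      rw [hN1, ← Matrix.fromBlocks_one]
      congr 1
    have hinv : ∀ v, ∃ w, A v w + v = 0 ∧ A w v + w = 0 := by
      intro v
      obtain ⟨w, hw⟩ := hA.exists_apply_eq v (-v)
      have h1 : A v w + v = 0 := by rw [hw, neg_add_cancel]
      refine ⟨w, h1, hT _ ?_⟩
      have h2 : A v * A w = 1 := by rw [← hA.map_circ, h1, hA.map_zero]
      obtain ⟨u, hu⟩ := hA.isUnit v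
      rw [hA.map_circ]
      rw [← hu] at h2 ⊢
      rw [← Units.inv_eq_of_mul_eq_one_right h2, Units.inv_mul]
    have hNinv : ∀ v w, A w v + w = 0 → N v * N w = 1 := fun v w h => by
      rw [← hNmul, h, hN1]
    have hPinv : ∀ v w, A w v + w = 0 → P v * P w = 1 := fun v w h => by
      rw [hPmul, h, hP1]
    choose i hi1 hi2 using hinv
    let g : (Fin n → F) → AGL n F := fun v =>
      ⟨⟨P v, P (i v), hPinv _ _ (hi2 v), hPinv _ _ (hi1 v)⟩,
        v, ⟨N v, N (i v), hNinv _ _ (hi2 v), hNinv _ _ (hi1 v)⟩, rfl⟩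
    have hg : ∀ v, ((g v : GL (Unit ⊕ Fin n) F)).val = P v := fun v => rfl
    have hext : ∀ x y : AGL n F, (x : GL (Unit ⊕ Fin n) F).val = (y : GL (Unit ⊕ Fin n) F).val →
        x = y := fun x y h => Subtype.ext (Units.ext h)
    have hgmul : ∀ v w, g v * g w = g (A w v + w) := fun v w => hext _ _ (hPmul v w)
    have hg1 : g 0 = 1 := hext _ _ hP1
    have hrow : ∀ v, ((g v : GL (Unit ⊕ Fin n) F)).val (Sum.inl ()) =
        Sum.elim (fun _ => 1) v := by
      intro v
      rw [hg]
      funext j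
      rcases j with j | j <;> simp [P]
    let R : Subgroup (AGL n F) :=
      { carrier := Set.range g
        one_mem' := ⟨0, hg1⟩
        mul_mem' := by
          rintro _ _ ⟨v, rfl⟩ ⟨w, rfl⟩
          exact ⟨_, (hgmul v w).symm⟩
        inv_mem' := by
          rintro _ ⟨v, rfl⟩
          refine ⟨i v, ?_⟩
          rw [eq_inv_iff_mul_eq_one, hgmul, hi1, hg1] }
    refine ⟨R, fun v => ⟨g v, ⟨⟨v, rfl⟩, hrow v⟩, ?_⟩, ?_⟩
    · rintro _ ⟨⟨w, rfl⟩, hw⟩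
      rw [hrow] at hw
      exact congrArg g (funext fun j => congrFun hw (Sum.inr j))
    · rw [eq_bot_iff]
      rintro _ ⟨⟨v, rfl⟩, hv⟩
      have h1 := (htrans _).1 hv
      rw [hg, Matrix.toBlocks_fromBlocks₂₂] at h1
      have : v = 0 := hT v (LinearMap.ext fun x => by rw [← hN, h1, Matrix.vecMul_one]; rfl)
      rw [Subgroup.mem_bot, this, hg1]

end AGL

/-! ### Constructions from quadratic forms, and the exceptional case -/

namespace IsRegularFamily

theorem exists_of_linearEquiv {F V V' : Type*} [Field F] [AddCommGroup V] [Module F V]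
    [AddCommGroup V'] [Module F V'] (E : V ≃ₗ[F] V') {A : V → End F V} (hA : IsRegularFamily A)
    (hT : IsTranslationFree A) :
    ∃ A' : V' → End F V', IsRegularFamily A' ∧ IsTranslationFree A' := by
  refine ⟨fun v => E.conjRingEquiv (A (E.symm v)), ⟨?_, fun v w => ?_, fun v => ?_⟩,
    fun v hv => ?_⟩
  · rw [_root_.map_zero, hA.map_zero, map_one]
  · rw [← map_mul, ← hA.map_circ, map_add]
    congr 3
    simp [LinearEquiv.conjRingEquiv]
  · exact (hA.isUnit _).map E.conjRingEquiv
  · have := hT _ (E.conjRingEquiv.injective (hv.trans (map_one _).symm))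
    simpa using this

/-- A translation-free regular subgroup built from a nondegenerate quadratic form `Q` with polar
form `b` and a faithful unipotent representation `e` of `F × S` by isometries of `Q`. -/
theorem exists_of_isometries {F W S : Type*} [Field F] [AddCommGroup W] [Module F W]
    [FiniteDimensional F W] [AddCommGroup S] [Module F S] [FiniteDimensional F S] (Q : W → F)
    (b : W →ₗ[F] W →ₗ[F] F) (hQ : ∀ x y, Q (x + y) = Q x + Q y + b x y)
    (hb : ∀ y, (∀ x, b x y = 0) → y = 0) (e : F × S → End F W) (he0 : e 0 = 1)
    (hadd : ∀ p q, e (p + q) = e q * e p) (hinj : ∀ p, e p = 1 → p = 0)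
    (heQ : ∀ p x, Q (e p x) = Q x) :
    ∃ A : W × F × S → End F (W × F × S), IsRegularFamily A ∧ IsTranslationFree A := by
  have hQ0 : Q 0 = 0 := by simpa using hQ 0 0
  have heb : ∀ p x y, b (e p x) (e p y) = b x y := by
    intro p x y
    have h := hQ (e p x) (e p y)
    rw [← map_add, heQ, heQ, heQ, hQ] at h
    linear_combination -h
  -- The law adds a polar term to the middle coordinate, and subtracting `Q` cancels it: `f` is a
  -- homomorphism to the additive group `F × S`.
  let f : W × F × S → F × S := fun v => (v.2.1 - Q v.1, v.2.2)
  let A : W × F × S → End F (W × F × S) := fun v =>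
    (e (f v) ∘ₗ LinearMap.fst F W (F × S)).prod
      ((LinearMap.fst F F S ∘ₗ LinearMap.snd F W (F × S) +
        b.flip v.1 ∘ₗ e (f v) ∘ₗ LinearMap.fst F W (F × S)).prod
      (LinearMap.snd F F S ∘ₗ LinearMap.snd F W (F × S)))
  have hAv : ∀ v x, A v x = (e (f v) x.1, x.2.1 + b (e (f v) x.1) v.1, x.2.2) := fun v x => rfl
  have hf0 : f 0 = 0 := by simp [f, hQ0]
  have hfadd : ∀ v w, f (A w v + w) = f v + f w := by
    intro v w
    simp only [f, hAv, Prod.fst_add, Prod.snd_add, Prod.mk_add_mk, hQ, heQ]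
    ext
    · simp only
      ring
    · rfl
  refine ⟨A, ⟨?_, fun v w => ?_, fun v => ?_⟩, fun v hv => ?_⟩
  · ext x <;> simp [hAv, hf0, he0]
  · refine LinearMap.ext fun x => ?_
    rw [Module.End.mul_apply, hAv, hfadd, hadd, hAv w, hAv v x]
    refine Prod.ext rfl (Prod.ext ?_ rfl)
    simp only [Module.End.mul_apply, hAv, Prod.fst_add, map_add]
    rw [heb]
    ring
  · rw [LinearMap.isUnit_iff_ker_eq_bot, LinearMap.ker_eq_bot']
    intro x hx
    rw [hAv, Prod.mk_eq_zero, Prod.mk_eq_zero] at hx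
    obtain ⟨h1, h2, h3⟩ := hx
    have hx1 : x.1 = 0 := by
      have h4 : e (-f v) * e (f v) = 1 := by rw [← hadd, add_neg_cancel, he0]
      have := LinearMap.congr_fun h4 x.1
      rwa [Module.End.mul_apply, h1, _root_.map_zero, Module.End.one_apply, eq_comm] at this
    rw [h1, _root_.map_zero, LinearMap.zero_apply, add_zero] at h2
    exact Prod.ext hx1 (Prod.ext h2 h3)
  · have hx : ∀ x, A v x = x := fun x => by rw [hv]; rfl
    have h1 : e (f v) = 1 := LinearMap.ext fun x => congrArg Prod.fst (hx (x, 0))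
    have h2 : v.1 = 0 := hb _ fun x => by
      have := congrArg (fun y => y.2.1) (hx (x, 0))
      simpa [hAv, h1] using this
    have h3 := hinj _ h1
    simp only [f, h2, hQ0, sub_zero, Prod.mk_eq_zero] at h3
    exact Prod.ext h2 (Prod.ext h3.1 h3.2)

/-- The construction for the ternary form `x₂ ^ 2 - 2 x₁ x₃` and a one-parameter unipotent group of
its isometries. -/
theorem exists_of_two_ne_zero {F : Type*} [Field F] (h2 : (2 : F) ≠ 0) :
    ∃ A : (F × F × F) × F × (Fin 0 → F) → End F ((F × F × F) × F × (Fin 0 → F)),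
      IsRegularFamily A ∧ IsTranslationFree A := by
  refine exists_of_isometries (fun x => x.2.1 ^ 2 - 2 * (x.1 * x.2.2))
    (LinearMap.mk₂ F (fun x y => 2 * (x.2.1 * y.2.1) - 2 * (x.1 * y.2.2) - 2 * (x.2.2 * y.1))
      ?_ ?_ ?_ ?_) ?_ ?_
    -- This is the exponential of `p.1` times the nilpotent map `x ↦ (0, 2 x₁, 2 x₂)`; the factors
    -- `2` avoid denominators.
    (fun p =>
      { toFun := fun x => (x.1, x.2.1 + 2 * p.1 * x.1,
          x.2.2 + 2 * p.1 * x.2.1 + 2 * p.1 ^ 2 * x.1)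
        map_add' := ?_
        map_smul' := ?_ }) ?_ ?_ ?_ ?_
  · intros; simp; ring
  · intros; simp; ring
  · intros; simp; ring
  · intros; simp; ring
  · intros; simp; ring
  · intro y h
    have h3 := h (1, 0, 0)
    have h4 := h (0, 1, 0)
    have h5 := h (0, 0, 1)
    simp [h2] at h3 h4 h5
    exact Prod.ext h5 (Prod.ext h4 h3)
  · intro x y
    ext <;> simp <;> ring
  · intro c x
    ext <;> simp <;> ring
  · ext <;> simp
  · intro p q
    refine LinearMap.ext fun x => ?_
    ext <;> simp <;> ring
  · intro p h
    have := congrArg (fun y => y.2.1) (LinearMap.congr_fun h (1, 0, 0))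
    simp [h2] at this
    exact Prod.ext this (Subsingleton.elim _ _)
  · intro p x
    simp
    ring

/-- The construction for the hyperbolic form on `F ^ (4 + 2 m)` and a two-parameter unipotent group
of isometries acting on the first four coordinates. -/
theorem exists_of_hyperbolic {F : Type*} [Field F] (m : ℕ) {S : Type*} [AddCommGroup S]
    [Module F S] [FiniteDimensional F S] (σ : S →ₗ[F] F) (hσ : Function.Injective σ) :
    ∃ A : ((F × F × F × F) × (Fin m → F) × (Fin m → F)) × F × S →
        End F (((F × F × F × F) × (Fin m → F) × (Fin m → F)) × F × S),
      IsRegularFamily A ∧ IsTranslationFree A := by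
  refine exists_of_isometries
    (fun x => x.1.1 * x.1.2.2.1 + x.1.2.1 * x.1.2.2.2 + x.2.1 ⬝ᵥ x.2.2)
    (LinearMap.mk₂ F (fun x y => x.1.1 * y.1.2.2.1 + x.1.2.1 * y.1.2.2.2 + x.2.1 ⬝ᵥ y.2.2 +
      (y.1.1 * x.1.2.2.1 + y.1.2.1 * x.1.2.2.2 + y.2.1 ⬝ᵥ x.2.2)) ?_ ?_ ?_ ?_) ?_ ?_
    -- The product of two commuting isometries, with parameters `p.1` and `σ p.2`; no division
    -- occurs, so characteristic two is allowed.
    (fun p =>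
      { toFun := fun x => ((x.1.1, x.1.2.1 + p.1 * x.1.1,
          x.1.2.2.1 - p.1 * x.1.2.2.2 - σ p.2 * (x.1.2.1 + p.1 * x.1.1),
          x.1.2.2.2 + σ p.2 * x.1.1), x.2)
        map_add' := ?_
        map_smul' := ?_ }) ?_ ?_ ?_ ?_
  · intros; simp; ring
  · intros; simp; ring
  · intros; simp; ring
  · intros; simp; ring
  · intros; simp; ring
  · rintro ⟨⟨y₁, y₂, y₃, y₄⟩, y₅, y₆⟩ h
    have h1 := h ((1, 0, 0, 0), 0, 0)
    have h2 := h ((0, 1, 0, 0), 0, 0)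
    have h3 := h ((0, 0, 1, 0), 0, 0)
    have h4 := h ((0, 0, 0, 1), 0, 0)
    have h5 : ∀ i, y₅ i = 0 := fun i => by simpa using h (0, 0, Pi.single i 1)
    have h6 : ∀ i, y₆ i = 0 := fun i => by simpa using h (0, Pi.single i 1, 0)
    simp at h1 h2 h3 h4
    simp [h1, h2, h3, h4, funext_iff, h5, h6]
  · intro x y
    ext <;> simp <;> ring
  · intro c x
    ext <;> simp <;> ring
  · refine LinearMap.ext fun x => ?_
    simp
  · intro p q
    refine LinearMap.ext fun x => ?_
    ext <;> simp <;> ring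
  · intro p h
    have h1 := congrArg (fun y => y.1.2.1) (LinearMap.congr_fun h ((1, 0, 0, 0), 0))
    have h2 := congrArg (fun y => y.1.2.2.2) (LinearMap.congr_fun h ((1, 0, 0, 0), 0))
    simp at h1 h2
    exact Prod.ext h1 (hσ (h2.trans (_root_.map_zero σ).symm))
  · intro p x
    simp
    ring

/-- The translation-free regular subgroup of the affine group of dimension three over the field of
two elements. -/
theorem exists_of_forall_eq {F : Type*} [Field F] (hF : ∀ x : F, x = 0 ∨ x = 1) :
    ∃ A : F × F × F → End F (F × F × F), IsRegularFamily A ∧ IsTranslationFree A := by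
  have h2 : (2 : F) = 0 := by
    rcases hF (1 + 1) with h | h
    · rw [← one_add_one_eq_two, h]
    · simp at h
  have hsq : ∀ x : F, x ^ 2 = x := fun x => by rcases hF x with rfl | rfl <;> simp
  let A : F × F × F → End F (F × F × F) := fun v =>
    { toFun := fun x => (x.1, x.2.1 + x.1 * (v.2.2 + v.1 * v.2.1),
        x.2.2 + x.1 * (v.2.2 + v.2.1 + v.1 * v.2.2) + x.2.1 * v.1)
      map_add' := fun x y => by ext <;> simp <;> ring
      map_smul' := fun c x => by ext <;> simp <;> ring }
  have hAv : ∀ v x, A v x = (x.1, x.2.1 + x.1 * (v.2.2 + v.1 * v.2.1),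
    x.2.2 + x.1 * (v.2.2 + v.2.1 + v.1 * v.2.2) + x.2.1 * v.1) := fun v x => rfl
  refine ⟨A, ⟨?_, ?_, fun v => ?_⟩, ?_⟩
  · refine LinearMap.ext fun x => ?_
    rw [hAv]
    simp
  · rintro ⟨v₁, v₂, v₃⟩ ⟨w₁, w₂, w₃⟩
    refine LinearMap.ext fun x => ?_
    simp only [Module.End.mul_apply, hAv, Prod.mk_add_mk]
    refine Prod.ext rfl (Prod.ext ?_ ?_)
    · rcases hF v₁ with rfl | rfl <;> rcases hF w₁ with rfl | rfl <;> simp <;> grind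
    · rcases hF v₁ with rfl | rfl <;> rcases hF w₁ with rfl | rfl <;> simp <;> grind
  · rw [LinearMap.isUnit_iff_ker_eq_bot, LinearMap.ker_eq_bot']
    rintro ⟨x₁, x₂, x₃⟩ hx
    simp only [hAv, Prod.mk_eq_zero] at hx
    obtain ⟨rfl, hx2, hx3⟩ := hx
    obtain rfl : x₂ = 0 := by simpa using hx2
    simpa using hx3
  · rintro ⟨v₁, v₂, v₃⟩ hv
    have h1 := LinearMap.congr_fun hv (0, 1, 0)
    have h3 := LinearMap.congr_fun hv (1, 0, 0)
    simp [hAv] at h1 h3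
    subst h1
    simp at h3
    obtain ⟨rfl, h3⟩ := h3
    simpa using h3

end IsRegularFamily

/-! ### The classification -/

theorem Nat.card_eq_two_iff_forall_eq_zero_or_one (F : Type*) [Field F] :
    Nat.card F = 2 ↔ ∀ x : F, x = 0 ∨ x = 1 := by
  rw [Nat.card_eq_two_iff' (0 : F)]
  constructor
  · rintro ⟨y, -, hy⟩ x
    by_cases hx : x = 0
    · exact Or.inl hx
    · exact Or.inr ((hy x hx).trans (hy 1 one_ne_zero).symm)
  · exact fun h => ⟨1, one_ne_zero, fun x hx => (h x).resolve_left hx⟩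

theorem mainTheorem4 (F : Type*) [Field F] (p : ℕ) [CharP F p] (hp : 0 < p)
    (n : ℕ) (hn : 1 ≤ n) :
    (∃ R : Subgroup (AGL n F), AGL.IsRegular R ∧ R ⊓ AGL.translations n F = ⊥) ↔
      (n = 3 ∧ Nat.card F = 2) ∨ (n = 4 ∧ 2 < p) ∨ 5 ≤ n := by
  have hprime : Fact p.Prime :=
    ⟨(CharP.char_is_prime_or_zero F p).resolve_right hp.ne'⟩
  have hdim : Module.finrank F (Fin n → F) = n := by simp
  rw [AGL.exists_isRegular_iff, Nat.card_eq_two_iff_forall_eq_zero_or_one]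
  constructor
  · rintro ⟨A, hA, hT⟩
    have hU := hA.unipotent p
    have : Nontrivial (Fin n → F) :=
      Module.nontrivial_of_finrank_pos (R := F) (by rw [hdim]; exact hn)
    have h3 := hA.three_le_finrank hT hU
    rw [hdim] at h3
    by_contra! h
    obtain ⟨hn3, hn4, hn5⟩ := h
    obtain rfl | rfl : n = 3 ∨ n = 4 := by omega
    · obtain ⟨y, hy0, hy1⟩ := hn3 rfl
      exact hA.false_of_finrank_eq_three hT hU hdim hy0 hy1
    · obtain rfl : p = 2 := le_antisymm (hn4 rfl) hprime.out.two_le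
      exact hA.false_of_finrank_eq_four hT hU hdim (CharP.cast_eq_zero F 2)
  · have key : ∀ {V : Type _} [AddCommGroup V] [Module F V] [FiniteDimensional F V],
        Module.finrank F V = n →
        (∃ A : V → Module.End F V, IsRegularFamily A ∧ IsTranslationFree A) →
        ∃ A : (Fin n → F) → Module.End F (Fin n → F), IsRegularFamily A ∧ IsTranslationFree A := by
      rintro V _ _ _ hV ⟨A, hA, hT⟩
      exact hA.exists_of_linearEquiv (LinearEquiv.ofFinrankEq _ _ (hV.trans hdim.symm)) hT
    rintro (⟨rfl, hF⟩ | ⟨rfl, h2⟩ | h5)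
    · exact key (by simp) (IsRegularFamily.exists_of_forall_eq hF)
    · refine key (by simp) (IsRegularFamily.exists_of_two_ne_zero fun h => ?_)
      have := (CharP.cast_eq_zero_iff F p 2).1 (by exact_mod_cast h)
      exact absurd (Nat.le_of_dvd two_pos this) (by omega)
    -- The hyperbolic construction has dimension `(4 + 2 m) + 1 + dim S`; taking `S` to be zero or
    -- `F` settles the parity.
    · obtain ⟨m, rfl | rfl⟩ : ∃ m, n = 5 + 2 * m ∨ n = 6 + 2 * m := ⟨(n - 5) / 2, by omega⟩
      · have hex := IsRegularFamily.exists_of_hyperbolic (F := F) m (S := Fin 0 → F) 0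
          (Function.injective_of_subsingleton _)
        refine key ?_ hex
        simp
        omega
      · have hex := IsRegularFamily.exists_of_hyperbolic (F := F) m LinearMap.id
          Function.injective_id
        refine key ?_ hex
        simp
        omega
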